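/- Let $M$ be a $W^*$-algebra and $E$ a $W^*$-correspondence over $M$: a self-dual right Hilbert $C^*$-module over $M$ with a left action of $M$ given by a normal unital $*$-homomorphism $\varphi:M\to\mathcal L(E)$, where $\mathcal L(\cdot)$ denotes the adjointable operators. Let $E^{\otimes k}$ be its tensor powers (self-dual and balanced over $M$, with $E^{\otimes 0}=M$), let $\varphi_k:M\to\mathcal L(E^{\otimes k})$ be the left action, and let $\varphi_k(M)^c$ be the commutant of $\varphi_k(M)$ in $\mathcal L(E^{\otimes k})$. A sequence $X=\{X_k\}_{k\ge1}$ is admissible if $X_k\in\varphi_k(M)^c$ and $X_k\ge0$ for all $k\geq 1$, $X_1$ is invertible, and $\limsup_k\|X_k\|^{1/k}<\infty$. For such $X$ put $R_0=I$ and $$R_k=\Big(\sum_{l=1}^k\ \sum_{i_1+\dots+i_l=k,\ i_j\ge1}X_{i_1}\otimes\cdots\otimes X_{i_l}\Big)^{1/2}\qquad(k\ge1).$$ A weight sequence is a sequence $Z=\{Z_k\}_{k\ge0}$ of invertible operators $Z_k\in\varphi_k(M)^c$ with $Z_0=I$ and $\sup_k\|Z_k\|<\infty$. It is associated with $X$ if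 $Z^{(m)*}Z^{(m)}=R_m^{-2}$ for all $m$, where $Z^{(m)}=Z_m(I_E\otimes Z_{m-1})\cdots(I_{E^{\otimes(m-1)}}\otimes Z_1)$ and $Z^{(0)}=I$. Consider the following three conditions on $X$ or $Z$. * Hypothesis B (for $Z$): there is $\epsilon>0$ with $Z_k\ge\epsilon I_{E^{\otimes k}}$ for all $k\ge1$. * Hypothesis C (for $X$): there is a real $a$ with $\limsup_k\|X_k\|^{1/k}<a$ and $aI_E\le X_1$. * Commutativity condition (for $X$): $R_k(I_E\otimes R_{k-1})=(I_E\otimes R_{k-1})R_k$ for all $k\ge2$. **Proposition.** If $X$ is admissible and satisfies Hypothesis C and the commutativity condition, then there is a weight sequence $Z$ associated with $X$ that satisfies Hypothesis B. Moreover, the commutativity condition holds for every admissible $X$, and so the conclusion holds for every admissible $X$ that satisfies Hypothesis C, in each of the following cases: 1. $\varphi_k(M)^c\subseteq\mathcal L(E)\otimes I_{E^{\otimes(k-1)}}$ for all $k\ge2$; 2. $E={}_\alpha M$ for a $*$-automorphism $\alpha$ of $M$ (that is, $E=M$ as a right module, $\langle x,y\rangle=x^*y$, and $a\in M$ acts on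 the left as multiplication by $\alpha(a)$); 3. $M=\mathbb C$, $E=\mathbb C^d$, and every $X_k$ is diagonal in the standard basis of $(\mathbb C^d)^{\otimes k}$. -/

import Mathlib

open MulOpposite Filter
open scoped ENNReal ComplexOrder

universe u v w

set_option linter.unusedSectionVars false

section Adjointable

variable (M : Type*) [CStarAlgebra M] [PartialOrder M] [StarOrderedRing M] (F : Type*) [NormedAddCommGroup F] [NormedSpace ℂ F] [Module Mᵐᵒᵖ F]
  [CStarModule Mᵐᵒᵖ F]

/-- The `M`-valued inner product of a right Hilbert C*-module over `M`: it is linear in the second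
variable and satisfies `⟪x, y · a⟫ = ⟪x, y⟫ a`. (A right `M`-module is a module over `Mᵐᵒᵖ`.) -/
def minner (M : Type*) {F : Type*} [Inner Mᵐᵒᵖ F] (x y : F) : M := unop (inner Mᵐᵒᵖ x y)

variable {M F}

/-- A vector is determined by its inner products. -/
theorem minner_ext {x y : F} (h : ∀ z, minner M z x = minner M z y) : x = y := by
  rw [← sub_eq_zero, ← CStarModule.inner_self (A := Mᵐᵒᵖ), CStarModule.inner_sub_right, sub_eq_zero]
  exact unop_injective (h _)

theorem minner_star (x y : F) : star (minner M x y) = minner M y x := by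
  simp only [minner, ← unop_star, CStarModule.star_inner]

theorem norm_minner_le (x y : F) : ‖minner M x y‖ ≤ ‖x‖ * ‖y‖ := by
  exact CStarModule.norm_inner_le (A := Mᵐᵒᵖ) F (x := x) (y := y)

theorem norm_sq_minner (x : F) : ‖x‖ ^ 2 = ‖minner M x x‖ := by
  exact CStarModule.norm_sq_eq Mᵐᵒᵖ (x := x)

variable (M F)

/-- The algebra of adjointable operators on the Hilbert module `F`, inside the bounded operators.
Adjointable operators are automatically right `M`-linear. -/
def adjointableSubalgebra : Subalgebra ℂ (F →L[ℂ] F) where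
  carrier := {A | ∃ B : F →L[ℂ] F, ∀ x y, minner M (A x) y = minner M x (B y)}
  mul_mem' := by
    rintro A A' ⟨B, hB⟩ ⟨B', hB'⟩
    exact ⟨B' * B, fun x y => by simp [hB, hB']⟩
  add_mem' := by
    rintro A A' ⟨B, hB⟩ ⟨B', hB'⟩
    refine ⟨B + B', fun x y => ?_⟩
    have h1 := hB x y
    have h2 := hB' x y
    simp only [minner] at h1 h2
    simp [minner, h1, h2]
  algebraMap_mem' := by
    intro r
    refine ⟨algebraMap ℂ _ (star r), fun x y => ?_⟩
    simp [minner, Algebra.algebraMap_eq_smul_one]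

/-- `𝓛(F)`, the C*-algebra of adjointable operators on the Hilbert C*-module `F`. -/
def AdjointableOp : Type _ := adjointableSubalgebra M F

namespace AdjointableOp

noncomputable instance : NormedRing (AdjointableOp M F) :=
  inferInstanceAs (NormedRing (adjointableSubalgebra M F))

noncomputable instance : NormedAlgebra ℂ (AdjointableOp M F) :=
  inferInstanceAs (NormedAlgebra ℂ (adjointableSubalgebra M F))

variable {M F}

/-- The underlying bounded operator of an adjointable operator. -/
def toCLM (A : AdjointableOp M F) : F →L[ℂ] F := Subtype.val (p := (· ∈ adjointableSubalgebra M F)) A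

instance : CoeFun (AdjointableOp M F) (fun _ => F → F) := ⟨fun A => A.toCLM⟩

@[ext] theorem ext {A B : AdjointableOp M F} (h : ∀ x, A x = B x) : A = B :=
  Subtype.ext (ContinuousLinearMap.ext h)

theorem exists_adjoint (A : AdjointableOp M F) :
    ∃ B : AdjointableOp M F, ∀ x y, minner M (A x) y = minner M x (B y) := by
  obtain ⟨B, hB⟩ := A.2
  refine ⟨⟨B, A.toCLM, fun x y => ?_⟩, hB⟩
  rw [← minner_star y]
  exact (congrArg star (hB y x)).symm.trans (minner_star _ _)

noncomputable instance : Star (AdjointableOp M F) := ⟨fun A => A.exists_adjoint.choose⟩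

theorem minner_star_apply (A : AdjointableOp M F) (x y : F) :
    minner M (A x) y = minner M x (star A y) :=
  A.exists_adjoint.choose_spec x y

theorem eq_star {A B : AdjointableOp M F} (h : ∀ x y, minner M (A x) y = minner M x (B y)) :
    B = star A :=
  ext fun y => minner_ext (M := M) fun x => by rw [← h, minner_star_apply]

@[simp] theorem add_apply (A B : AdjointableOp M F) (x : F) : (A + B) x = A x + B x := rfl
@[simp] theorem mul_apply (A B : AdjointableOp M F) (x : F) : (A * B) x = A (B x) := rfl
@[simp] theorem one_apply (x : F) : (1 : AdjointableOp M F) x = x := rfl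
@[simp] theorem smul_apply (c : ℂ) (A : AdjointableOp M F) (x : F) : (c • A) x = c • A x := rfl

noncomputable instance : StarRing (AdjointableOp M F) where
  star_involutive A := (eq_star fun x y => by
    rw [← minner_star y, ← minner_star_apply A, minner_star]).symm
  star_mul A B := (eq_star fun x y => by simp [minner_star_apply]).symm
  star_add A B := (eq_star fun x y => by
    have h1 := minner_star_apply A x y
    have h2 := minner_star_apply B x y
    simp only [minner] at h1 h2
    simp [minner, h1, h2]).symm

instance : StarModule ℂ (AdjointableOp M F) where
  star_smul c A := (eq_star fun x y => by
    have h1 := minner_star_apply A x y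
    simp only [minner] at h1
    simp [minner, h1]).symm

theorem norm_apply_le (A : AdjointableOp M F) (x : F) : ‖A x‖ ≤ ‖A‖ * ‖x‖ := A.toCLM.le_opNorm x

instance : CStarRing (AdjointableOp M F) where
  norm_mul_self_le A := by
    have h : ‖A‖ ≤ √‖star A * A‖ := by
      refine A.toCLM.opNorm_le_bound (Real.sqrt_nonneg _) fun x => ?_
      refine le_of_sq_le_sq ?_ (by positivity)
      rw [mul_pow, Real.sq_sqrt (norm_nonneg _), norm_sq_minner (M := M)]
      change ‖minner M (A x) (A x)‖ ≤ _
      rw [minner_star_apply]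
      calc _ ≤ ‖x‖ * ‖(star A * A) x‖ := norm_minner_le _ _
        _ ≤ ‖x‖ * (‖star A * A‖ * ‖x‖) := by gcongr; exact norm_apply_le _ _
        _ = _ := by ring
    calc _ ≤ √‖star A * A‖ * √‖star A * A‖ := by gcongr
      _ = _ := Real.mul_self_sqrt (norm_nonneg _)

theorem norm_star_le (A : AdjointableOp M F) : ‖star A‖ = ‖A‖ := norm_star _

variable [CompleteSpace F]

instance : CompleteSpace (AdjointableOp M F) := by
  refine Metric.complete_of_cauchySeq_tendsto fun u hu => ?_
  have hu' : CauchySeq fun n => star (u n) := by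
    rw [Metric.cauchySeq_iff] at hu ⊢
    intro ε hε
    obtain ⟨N, hN⟩ := hu ε hε
    refine ⟨N, fun m hm n hn => ?_⟩
    rw [dist_eq_norm, ← star_sub, norm_star, ← dist_eq_norm]
    exact hN m hm n hn
  have hi : Isometry (fun A : AdjointableOp M F => (A.toCLM : F →L[ℂ] F)) := fun _ _ => rfl
  obtain ⟨A, hA⟩ := cauchySeq_tendsto_of_complete (hi.uniformContinuous.comp_cauchySeq hu)
  obtain ⟨B, hB⟩ := cauchySeq_tendsto_of_complete (hi.uniformContinuous.comp_cauchySeq hu')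
  have hc : Continuous fun p : F × F => minner M p.1 p.2 :=
    continuous_unop.comp (CStarModule.continuous_inner (A := Mᵐᵒᵖ))
  have hmem : ∀ x y, minner M (A x) y = minner M x (B y) := fun x y => by
    have h1 := (hc.tendsto (A x, y)).comp
      ((((ContinuousLinearMap.apply ℂ F x).continuous.tendsto A).comp hA).prodMk_nhds
        (tendsto_const_nhds (x := y)))
    have h2 := (hc.tendsto (x, B y)).comp
      ((tendsto_const_nhds (x := x)).prodMk_nhds
        (((ContinuousLinearMap.apply ℂ F y).continuous.tendsto B).comp hB))
    refine tendsto_nhds_unique h1 (h2.congr fun n => ?_)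
    exact (minner_star_apply (u n) x y).symm
  exact ⟨⟨A, B, hmem⟩, (hi.isEmbedding.tendsto_nhds_iff).2 hA⟩

noncomputable instance : CStarAlgebra (AdjointableOp M F) where

/-- The usual order of a C*-algebra: `A ≤ B` iff `B - A` is positive. -/
noncomputable instance : PartialOrder (AdjointableOp M F) := CStarAlgebra.spectralOrder _

instance : StarOrderedRing (AdjointableOp M F) := CStarAlgebra.spectralOrderedRing _

end AdjointableOp

end Adjointable

section Correspondence

/-- A normal `*`-homomorphism between C*-algebras: it preserves the suprema of (bounded) increasing
nets of self-adjoint elements. For W*-algebras this is ultraweak continuity. -/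
def IsNormalHom {M N : Type*} [CStarAlgebra M] [PartialOrder M] [CStarAlgebra N] [PartialOrder N]
    (φ : M →⋆ₐ[ℂ] N) : Prop :=
  ∀ D : Set M, D.Nonempty → (∀ x ∈ D, IsSelfAdjoint x) → DirectedOn (· ≤ ·) D →
    ∀ s, IsLUB D s → IsLUB (φ '' D) (φ s)

/-- A W*-correspondence over the W*-algebra `M`: a self-dual right Hilbert C*-module over `M` with a
left action of `M` given by a normal unital `*`-homomorphism into the adjointable operators. -/
structure WStarCorrespondence (M : Type u) [CStarAlgebra M] [PartialOrder M]
    [StarOrderedRing M] where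
  carrier : Type v
  [normedAddCommGroup : NormedAddCommGroup carrier]
  [normedSpace : NormedSpace ℂ carrier]
  [completeSpace : CompleteSpace carrier]
  [module : Module Mᵐᵒᵖ carrier]
  [cstarModule : CStarModule Mᵐᵒᵖ carrier]
  /-- every bounded right `M`-linear functional is an inner product -/
  selfDual : ∀ f : carrier →L[Mᵐᵒᵖ] M, ∃ g, ∀ x, f x = minner M g x
  /-- the left action -/
  left : M →⋆ₐ[ℂ] AdjointableOp M carrier
  normal : IsNormalHom left

attribute [instance] WStarCorrespondence.normedAddCommGroup WStarCorrespondence.normedSpace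
  WStarCorrespondence.completeSpace WStarCorrespondence.module WStarCorrespondence.cstarModule

namespace WStarCorrespondence

variable {M : Type u} [CStarAlgebra M] [PartialOrder M] [StarOrderedRing M]

instance : CoeSort (WStarCorrespondence.{u, v} M) (Type v) := ⟨carrier⟩

/-- `𝓛(E)`. -/
abbrev Op (E : WStarCorrespondence.{u, v} M) : Type v := AdjointableOp M E

/-- `φ(M)ᶜ`, the relative commutant in `𝓛(E)` of the image of the left action. -/
def leftCommutant (E : WStarCorrespondence.{u, v} M) : Set E.Op :=
  {A | ∀ a : M, A * E.left a = E.left a * A}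

/-- Isomorphisms of W*-correspondences. A bijection that preserves the `M`-valued inner product is
automatically linear and right `M`-linear. -/
structure Iso (E : WStarCorrespondence.{u, v} M) (F : WStarCorrespondence.{u, w} M)
    extends E ≃ F where
  inner_map : ∀ x y : E, minner M (toFun x) (toFun y) = minner M x y
  left_map : ∀ (a : M) (x : E), toFun (E.left a x) = F.left a (toFun x)

/-- `t : E × F → G`, `(x, y) ↦ x ⊗ y`, exhibits the W*-correspondence `G` as the (self-dual)
tensor product of `E` and `F` balanced over `M`: the inner product and the left action are the usual
ones on elementary tensors, and `G` is Paschke's self-dual completion of the `M`-linear span of the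
elementary tensors, i.e. the inner products with the elements of `G` are exactly the bounded
`M`-linear functionals on that span. (The formula for the inner product makes `t` biadditive and
`M`-balanced.) -/
structure IsTensorProduct {E F G : WStarCorrespondence M} (t : E → F → G) : Prop where
  inner_tmul : ∀ (x x' : E) (y y' : F),
    minner M (t x y) (t x' y') = minner M y (F.left (minner M x x') y')
  left_tmul : ∀ (a : M) (x : E) (y : F), G.left a (t x y) = t (E.left a x) y
  existsUnique_dual :
    ∀ f : Submodule.span Mᵐᵒᵖ (Set.range fun p : E × F => t p.1 p.2) →ₗ[Mᵐᵒᵖ] M,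
      (∃ C : ℝ, ∀ z, ‖f z‖ ≤ C * ‖(z : G)‖) → ∃! g : G, ∀ z, f z = minner M g (z : G)

end WStarCorrespondence
end Correspondence

section Examples

variable {M : Type u} [CStarAlgebra M] [PartialOrder M] [StarOrderedRing M]

/-- A C*-algebra as a right Hilbert C*-module over itself, with `⟪x, y⟫ = x* y`. -/
noncomputable instance selfHilbertModule : CStarModule Mᵐᵒᵖ M where
  inner x y := op (star x * y)
  inner_add_right := by simp [mul_add]
  inner_self_nonneg {x} := star_mul_self_nonneg x
  inner_self {x} := by
    rw [← op_zero, op_inj]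
    exact CStarRing.star_mul_self_eq_zero_iff x
  inner_op_smul_right {a x y} := by
    induction a with | h a => simp [mul_assoc]
  inner_smul_right_complex := by simp
  star_inner x y := by simp [← op_star]
  norm_eq_sqrt_norm_inner_self x := by
    rw [MulOpposite.norm_op, CStarRing.norm_star_mul_self, Real.sqrt_mul_self (norm_nonneg x)]

theorem minner_self_def (x y : M) : minner M x y = star x * y := rfl

/-- Left multiplication by `b`, as an adjointable operator on `M`. -/
noncomputable def leftMul (b : M) : AdjointableOp M M :=
  ⟨ContinuousLinearMap.mul ℂ M b, ContinuousLinearMap.mul ℂ M (star b), fun x y => by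
    simp [minner_self_def, mul_assoc]⟩

theorem leftMul_apply (b x : M) : leftMul b x = b * x := rfl

/-- The action of `M` on itself by left multiplication. -/
noncomputable def leftMulHom : M →⋆ₐ[ℂ] AdjointableOp M M where
  toFun := leftMul
  map_one' := AdjointableOp.ext fun x => by simp [leftMul_apply]
  map_mul' a b := AdjointableOp.ext fun x => by simp [leftMul_apply, mul_assoc]
  map_zero' := AdjointableOp.ext fun x => (leftMul_apply 0 x).trans (zero_mul x)
  map_add' a b := AdjointableOp.ext fun x => by simp [leftMul_apply, add_mul]
  commutes' r := AdjointableOp.ext fun x => by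
    simp [leftMul_apply, Algebra.algebraMap_eq_smul_one]
  map_star' a := AdjointableOp.eq_star fun x y => by
    simp [leftMul_apply, minner_self_def, mul_assoc]

theorem leftMulHom_bijective : Function.Bijective (leftMulHom (M := M)) := by
  constructor
  · intro a b h
    have := congrArg (fun A : AdjointableOp M M => A 1) h
    simpa [leftMulHom, leftMul_apply] using this
  · intro A
    refine ⟨A 1, AdjointableOp.ext fun x => minner_ext (M := M) fun z => ?_⟩
    have h1 := AdjointableOp.minner_star_apply (star A) z x
    have h2 := AdjointableOp.minner_star_apply (star A) z 1
    rw [star_star] at h1 h2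
    rw [← h1]
    change star z * (A 1 * x) = _
    rw [← mul_assoc]
    simp only [minner_self_def, mul_one] at h2 ⊢
    rw [← h2]

theorem isNormalHom_of_bijective {N : Type*} [CStarAlgebra N] [PartialOrder N] [StarOrderedRing N]
    (φ : M →⋆ₐ[ℂ] N) (h : Function.Bijective φ) : IsNormalHom φ := by
  let e : M ≃⋆ₐ[ℂ] N := StarAlgEquiv.ofBijective φ h
  have he : ∀ x y, φ x ≤ φ y ↔ x ≤ y := fun x y => map_le_map_iff e
  intro D _ _ _ s hs
  refine ⟨?_, fun b hb => ?_⟩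
  · rintro _ ⟨x, hx, rfl⟩
    exact (he _ _).2 (hs.1 hx)
  · obtain ⟨b, rfl⟩ := h.2 b
    exact (he _ _).2 (hs.2 fun x hx => (he _ _).1 (hb ⟨x, hx, rfl⟩))

/-- The correspondence `_αM` of an automorphism `α` of `M`: the right Hilbert module `M`, on which
`a ∈ M` acts from the left as multiplication by `α a`. -/
noncomputable def WStarCorrespondence.twist (α : M ≃⋆ₐ[ℂ] M) : WStarCorrespondence.{u, u} M where
  carrier := M
  selfDual f := ⟨star (f 1), fun x => by
    have := map_smul f (op x) (1 : M)
    simpa [minner_self_def] using this⟩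
  left := leftMulHom.comp (α : M →⋆ₐ[ℂ] M)
  normal := isNormalHom_of_bijective _ (leftMulHom_bijective.comp α.bijective)

/-- The identity correspondence `M`. -/
noncomputable abbrev WStarCorrespondence.identity (M : Type u) [CStarAlgebra M] [PartialOrder M]
    [StarOrderedRing M] : WStarCorrespondence.{u, u} M :=
  WStarCorrespondence.twist (StarAlgEquiv.refl ℂ M)

/-- `ℂᵈ` as a right Hilbert C*-module over `ℂ`. -/
noncomputable instance euclideanHilbertModule (d : ℕ) :
    CStarModule ℂᵐᵒᵖ (EuclideanSpace ℂ (Fin d)) where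
  inner x y := op (inner ℂ x y)
  inner_add_right {x y z} := by rw [_root_.inner_add_right, op_add]
  inner_self_nonneg {x} := by
    change (0 : ℂ) ≤ inner ℂ x x
    rw [inner_self_eq_norm_sq_to_K, ← RCLike.ofReal_pow]
    exact RCLike.ofReal_nonneg.2 (sq_nonneg ‖x‖)
  inner_self {x} := by
    rw [← op_zero, op_inj]
    exact inner_self_eq_zero
  inner_op_smul_right {a x y} := by
    induction a with | h a =>
    have h : (op a • y : EuclideanSpace ℂ (Fin d)) = a • y := by
      ext i; simp [mul_comm]
    rw [h, inner_smul_right, ← op_mul, mul_comm]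
  inner_smul_right_complex {z x y} := by rw [inner_smul_right, ← smul_eq_mul, op_smul]
  star_inner x y := by rw [← op_star]; exact congrArg op (inner_conj_symm y x)
  norm_eq_sqrt_norm_inner_self x := by
    rw [MulOpposite.norm_op, inner_self_eq_norm_sq_to_K, norm_pow, RCLike.norm_ofReal,
      abs_norm, Real.sqrt_sq (norm_nonneg x)]

/-- The action of `ℂ` on `ℂᵈ` by scalars. -/
noncomputable def scalarHom (d : ℕ) : ℂ →⋆ₐ[ℂ] AdjointableOp ℂ (EuclideanSpace ℂ (Fin d)) where
  toAlgHom := Algebra.ofId ℂ _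
  map_star' c := by
    change algebraMap ℂ _ (star c) = star (algebraMap ℂ _ c)
    exact algebraMap_star_comm c

theorem isNormalHom_complex {N : Type*} [CStarAlgebra N] [PartialOrder N] [StarOrderedRing N]
    (φ : ℂ →⋆ₐ[ℂ] N) : IsNormalHom φ := by
  intro D hne hsa _ s hs
  have hmono : Monotone φ := OrderHomClass.mono φ
  refine ⟨?_, fun b hb => ?_⟩
  · rintro _ ⟨x, hx, rfl⟩
    exact hmono (hs.1 hx)
  · have hreal : ∀ x ∈ D, ((x.re : ℝ) : ℂ) = x := fun x hx =>
      Complex.conj_eq_iff_re.1 (hsa x hx)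
    obtain ⟨x₀, hx₀⟩ := hne
    have hsr : ((s.re : ℝ) : ℂ) = s := by
      have h := (Complex.le_def.1 (hs.1 hx₀)).2
      rw [← hreal x₀ hx₀, Complex.ofReal_im] at h
      exact Complex.ext (by simp) (by simp [← h])
    have hlub : IsLUB (Complex.re '' D) s.re := by
      refine ⟨?_, fun t ht => ?_⟩
      · rintro _ ⟨x, hx, rfl⟩
        exact (Complex.le_def.1 (hs.1 hx)).1
      · have : s ≤ (t : ℂ) := hs.2 fun x hx => by
          rw [← hreal x hx]
          exact Complex.real_le_real.2 (ht ⟨x, hx, rfl⟩)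
        exact (Complex.le_def.1 this).1
    have hcl : s.re ∈ closure (Complex.re '' D) := hlub.mem_closure ⟨_, x₀, hx₀, rfl⟩
    have hc : Continuous fun r : ℝ => φ (r : ℂ) := by
      have h : (fun r : ℝ => φ (r : ℂ)) = fun r : ℝ => (r : ℂ) • (1 : N) := by
        funext r
        rw [← Algebra.algebraMap_eq_smul_one]
        exact AlgHomClass.commutes φ (r : ℂ)
      rw [h]
      exact Complex.continuous_ofReal.smul continuous_const
    have hclosed : IsClosed {r : ℝ | φ (r : ℂ) ≤ b} := isClosed_le hc continuous_const
    have := closure_minimal (s := Complex.re '' D) (t := {r : ℝ | φ (r : ℂ) ≤ b}) (by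
      rintro _ ⟨x, hx, rfl⟩
      change φ _ ≤ b
      rw [hreal x hx]
      exact hb ⟨x, hx, rfl⟩) hclosed hcl
    change φ _ ≤ b at this
    rwa [hsr] at this

/-- The W*-correspondence `ℂᵈ` over `ℂ`. -/
noncomputable def WStarCorrespondence.euclidean (d : ℕ) : WStarCorrespondence.{0, 0} ℂ where
  carrier := EuclideanSpace ℂ (Fin d)
  selfDual f := by
    let F : EuclideanSpace ℂ (Fin d) →L[ℂ] ℂ :=
      { toFun := f
        map_add' := map_add f
        map_smul' := fun c x => by
          have h : (c • x : EuclideanSpace ℂ (Fin d)) = op c • x := by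
            ext i; simp [mul_comm]
          rw [h, map_smul]
          simp [mul_comm]
        cont := f.continuous }
    refine ⟨(InnerProductSpace.toDual ℂ _).symm F, fun x => ?_⟩
    change F x = inner ℂ _ x
    rw [InnerProductSpace.toDual_symm_apply]
  left := scalarHom d
  normal := isNormalHom_complex _

end Examples

/-- The tensor powers `E^{⊗k}`, `k ≥ 0`, of the W*-correspondence `E`, with the concatenation maps
`E^{⊗l} × E^{⊗m} → E^{⊗(l+m)}`: `E^{⊗0}` is the identity correspondence `M`, `E^{⊗1}` is `E`, and
`E^{⊗(l+m)}` is the self-dual tensor product of `E^{⊗l}` and `E^{⊗m}` balanced over `M`,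
associatively and with the two actions of `M` as unit laws. These data are determined by `E` up to a
unique isomorphism that is compatible with all of them. -/
structure TensorPowers {M : Type u} [CStarAlgebra M] [PartialOrder M] [StarOrderedRing M]
    (E : WStarCorrespondence.{u, v} M) where
  pow : ℕ → WStarCorrespondence.{u, w} M
  zeroIso : (WStarCorrespondence.identity M).Iso (pow 0)
  oneIso : E.Iso (pow 1)
  tmul : ∀ {l m n : ℕ}, l + m = n → pow l → pow m → pow n
  isTensorProduct : ∀ {l m n : ℕ} (h : l + m = n),
    WStarCorrespondence.IsTensorProduct (tmul h : pow l → pow m → pow n)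
  tmul_assoc : ∀ {l m n p q r : ℕ} (h₁ : l + m = p) (h₂ : p + n = q) (h₃ : m + n = r)
    (h₄ : l + r = q) (x : pow l) (y : pow m) (z : pow n),
    tmul h₂ (tmul h₁ x y) z = tmul h₄ x (tmul h₃ y z)
  zero_tmul : ∀ {m : ℕ} (a : M) (x : pow m),
    tmul (Nat.zero_add m) (zeroIso.toEquiv a) x = (pow m).left a x
  tmul_zero : ∀ {m : ℕ} (x : pow m) (a : M),
    tmul (Nat.add_zero m) x (zeroIso.toEquiv a) = op a • x

namespace TensorPowers

variable {M : Type u} [CStarAlgebra M] [PartialOrder M] [StarOrderedRing M]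
  {E : WStarCorrespondence.{u, v} M} (T : TensorPowers.{u, v, w} E)

open Classical in
/-- `A ⊗ B ∈ 𝓛(E^{⊗(l+m)})`, the operator with `(A ⊗ B)(x ⊗ y) = A x ⊗ B y`. It exists whenever `B`
commutes with the left action of `M`, and it is unique. -/
noncomputable def tensorOp {l m n : ℕ} (h : l + m = n) (A : (T.pow l).Op) (B : (T.pow m).Op) :
    (T.pow n).Op :=
  if hC : ∃ C : (T.pow n).Op, ∀ x y, C (T.tmul h x y) = T.tmul h (A x) (B y)
  then hC.choose else 0

/-- `I_E ⊗ B ∈ 𝓛(E^{⊗(k+1)})`. -/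
noncomputable def idTensor {k : ℕ} (B : (T.pow k).Op) : (T.pow (k + 1)).Op :=
  T.tensorOp (Nat.add_comm 1 k) 1 B

/-- A sequence `X = (X_k)` of operators `X_k ∈ 𝓛(E^{⊗k})`. -/
abbrev OpSeq : Type w := ∀ k : ℕ, (T.pow k).Op

/-- Admissible sequences `X = (X_k)_{k ≥ 1}`. (The entry `X 0` plays no role.) -/
structure IsAdmissible (X : T.OpSeq) : Prop where
  mem_commutant : ∀ k, 1 ≤ k → X k ∈ (T.pow k).leftCommutant
  nonneg : ∀ k, 1 ≤ k → 0 ≤ X k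
  isUnit_one : IsUnit (X 1)
  limsup_lt_top : limsup (fun k : ℕ => ‖X k‖ₑ ^ ((k : ℝ)⁻¹)) atTop < ∞

/-- Hypothesis C: there is a real `a` with `(limsup ‖X_k‖^{1/k}) I_E < a I_E ≤ X_1`. -/
def HypothesisC (X : T.OpSeq) : Prop :=
  ∃ a : ℝ, limsup (fun k : ℕ => ‖X k‖ₑ ^ ((k : ℝ)⁻¹)) atTop < ENNReal.ofReal a ∧
    a • (1 : (T.pow 1).Op) ≤ X 1

/-- `X_{c₁} ⊗ X_{c₂} ⊗ ⋯ ⊗ X_{c_l} ∈ 𝓛(E^{⊗n})` for a list `c` with sum `n`. -/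
noncomputable def tensorList (X : T.OpSeq) : ∀ (c : List ℕ) {n : ℕ}, c.sum = n → (T.pow n).Op
  | [], _, _ => 1
  | a :: c, _, h => T.tensorOp (List.sum_cons.symm.trans h) (X a) (tensorList X c rfl)

/-- `R_k`, the positive square root of the sum of `X_{α(1)} ⊗ ⋯ ⊗ X_{α(l)}` over all `l` and all
`l`-tuples `α` of positive integers with sum `k`; `R_0 = I`. -/
noncomputable def R (X : T.OpSeq) (k : ℕ) : (T.pow k).Op :=
  CFC.sqrt (∑ c : Composition k, T.tensorList X c.blocks c.blocks_sum)

/-- `Z^{(m)} = Z_m (I_E ⊗ Z_{m-1}) (I_{E^{⊗2}} ⊗ Z_{m-2}) ⋯ (I_{E^{⊗(m-1)}} ⊗ Z_1)`. -/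
noncomputable def weightProd (Z : T.OpSeq) : ∀ m : ℕ, (T.pow m).Op
  | 0 => 1
  | m + 1 => Z (m + 1) * T.idTensor (weightProd Z m)

/-- Weight sequences `Z = (Z_k)_{k ≥ 0}` on `(M, E)`. -/
structure IsWeightSequence (Z : T.OpSeq) : Prop where
  mem_commutant : ∀ k, Z k ∈ (T.pow k).leftCommutant
  zero : Z 0 = 1
  bddAbove : BddAbove (Set.range fun k => ‖Z k‖)
  isUnit : ∀ k, IsUnit (Z k)

/-- `Z` is a weight sequence associated with `X`: `Z^{(m)*} Z^{(m)} = R_m^{-2}` for all `m`. -/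
structure IsAssociated (X Z : T.OpSeq) : Prop extends T.IsWeightSequence Z where
  star_mul_self : ∀ m, star (T.weightProd Z m) * T.weightProd Z m = Ring.inverse (T.R X m ^ 2)

/-- Hypothesis B: the `Z_k` are uniformly bounded below. -/
def HypothesisB (Z : T.OpSeq) : Prop :=
  ∃ ε : ℝ, 0 < ε ∧ ∀ k, 1 ≤ k → ε • (1 : (T.pow k).Op) ≤ Z k

/-- `R_k` commutes with `I_E ⊗ R_{k-1}` for every `k ≥ 2`. -/
def CommutativityCondition (X : T.OpSeq) : Prop :=
  ∀ k, 1 ≤ k → T.R X (k + 1) * T.idTensor (T.R X k) = T.idTensor (T.R X k) * T.R X (k + 1)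

/-- `φ_k(M)ᶜ ⊆ 𝓛(E) ⊗ I_{k-1}` for every `k ≥ 2`. -/
def CommutantsInFirstFactor : Prop :=
  ∀ k, 1 ≤ k → ∀ A ∈ (T.pow (k + 1)).leftCommutant,
    ∃ B : (T.pow 1).Op, A = T.tensorOp (Nat.add_comm 1 k) B (1 : (T.pow k).Op)

end TensorPowers

/-- The vector `e_{w₁} ⊗ ⋯ ⊗ e_{w_k}` of the standard basis of `(ℂᵈ)^{⊗k}`. -/
noncomputable def TensorPowers.basisVector {d : ℕ}
    (T : TensorPowers.{0, 0, w} (WStarCorrespondence.euclidean d)) :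
    ∀ k : ℕ, (Fin k → Fin d) → T.pow k
  | 0, _ => T.zeroIso.toEquiv (1 : ℂ)
  | k + 1, i => T.tmul (Nat.add_comm 1 k) (T.oneIso.toEquiv (EuclideanSpace.single (i 0) (1 : ℂ)))
      (TensorPowers.basisVector T k (Fin.tail i))

/-- The matrix of `A ∈ 𝓛((ℂᵈ)^{⊗k})` in the standard basis is diagonal. -/
def TensorPowers.IsDiagonal {d : ℕ}
    (T : TensorPowers.{0, 0, w} (WStarCorrespondence.euclidean d)) {k : ℕ} (A : (T.pow k).Op) :
    Prop :=
  ∀ i : Fin k → Fin d, ∃ c : ℂ, A (T.basisVector k i) = c • T.basisVector k i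

/-!
Write `S_k = R_k²`, the sum of `X_{c₁} ⊗ ⋯ ⊗ X_{c_l}` over the compositions `c` of `k`
(`TensorPowers.compositionSum`). The weights are `Z_m = R_m⁻¹ (I_E ⊗ R_{m-1})`; their product
telescopes to `Z^{(m)} = R_m⁻¹`, so `Z` is associated with `X` as soon as it is a weight sequence.

Both bounds on `Z` come from comparing `S_{m+1}` with `I_E ⊗ S_m`. Sorting compositions by their
first block gives `S_{m+1} = ∑_i X_{i+1} ⊗ S_{m-i}` (`compositionSum_succ`). The term `i = 0` and
`a I_E ≤ X_1` give `a (I_E ⊗ S_m) ≤ S_{m+1}`, which iterates to `a^i (I_i ⊗ S_{m-i}) ≤ S_m`; hence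
`X_{i+1} ⊗ S_{m-i} ≤ ‖X_{i+1}‖ a^{-i} (I_E ⊗ S_m)`, and `∑_i ‖X_{i+1}‖ a^{-i}` converges because
`limsup ‖X_k‖^{1/k} < a`. So `a (I_E ⊗ S_m) ≤ S_{m+1} ≤ C (I_E ⊗ S_m)` with `C` independent of `m`.
When `R_{m+1}` and `I_E ⊗ R_m` commute, `Z_{m+1}` is positive and operator monotonicity of the square
root turns this into `C^{-1/2} ≤ Z_{m+1} ≤ a^{-1/2}`.

The tensor product `A ⊗ B` of operators, for `B` in the commutant of the left action, has to be
constructed on a self-dual completion. For unitaries it preserves the inner products of elementary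
tensors, and the universal property of the completion, with the closed graph theorem and
self-duality, extends it to an adjointable operator (`IsSelfDualCompletion.exists_op`). The general
case follows since a C*-algebra, here `𝓛(E^{⊗l})` or the commutant, is spanned by its unitaries.

For the commutativity condition: operators `B ⊗ I` commute with `I_E ⊗ R_k`; the tensor powers of
`_αM` are of the form `_βM`, whose left action has central commutant; and for diagonal `X_k` the
operators `S_{k+1}` and `I_E ⊗ S_k` are diagonal, hence commute, and then so do their square roots.
-/

/-! ### Hilbert modules: elementary rules -/

section HilbertModule

variable {M : Type*} [CStarAlgebra M] [PartialOrder M] [StarOrderedRing M] {F : Type*}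
  [NormedAddCommGroup F] [NormedSpace ℂ F] [Module Mᵐᵒᵖ F] [CStarModule Mᵐᵒᵖ F]

theorem minner_add_right (x y z : F) : minner M x (y + z) = minner M x y + minner M x z := by
  simp [minner]

theorem minner_add_left (x y z : F) : minner M (x + y) z = minner M x z + minner M y z := by
  simp [minner]

theorem minner_sub_left (x y z : F) : minner M (x - y) z = minner M x z - minner M y z := by
  simp [minner]

@[simp] theorem minner_zero_left (z : F) : minner M 0 z = 0 := by simp [minner]

@[simp] theorem minner_zero_right (z : F) : minner M z 0 = 0 := by simp [minner]

theorem minner_opSMul_right (a : Mᵐᵒᵖ) (x y : F) : minner M x (a • y) = a • minner M x y := by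
  simp [minner, MulOpposite.smul_eq_mul_unop]

theorem minner_opSMul_left (a : Mᵐᵒᵖ) (x y : F) :
    minner M (a • x) y = star (unop a) * minner M x y := by
  simp [minner]

theorem minner_smul_right (c : ℂ) (x y : F) : minner M x (c • y) = c • minner M x y := by
  simp [minner]

theorem minner_smul_left (c : ℂ) (x y : F) : minner M (c • x) y = star c • minner M x y := by
  simp [minner]

/-- A vector is determined by its inner products, on the other side from `minner_ext`. -/
theorem minner_ext_left {x y : F} (h : ∀ z, minner M x z = minner M y z) : x = y :=
  minner_ext (M := M) fun z => by rw [← minner_star x, ← minner_star y, h]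

theorem norm_eq_of_minner_self_eq {F' : Type*} [NormedAddCommGroup F'] [NormedSpace ℂ F']
    [Module Mᵐᵒᵖ F'] [CStarModule Mᵐᵒᵖ F'] {x : F} {y : F'}
    (h : minner M x x = minner M y y) : ‖x‖ = ‖y‖ := by
  have h2 : ‖x‖ ^ 2 = ‖y‖ ^ 2 := by rw [norm_sq_minner (M := M), norm_sq_minner (M := M), h]
  exact (sq_eq_sq₀ (norm_nonneg _) (norm_nonneg _)).1 h2

theorem continuous_minner : Continuous fun p : F × F => minner M p.1 p.2 :=
  continuous_unop.comp (CStarModule.continuous_inner (A := Mᵐᵒᵖ))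

/-- The bounded `M`-linear functional `⟪g, ·⟫`. -/
noncomputable def minnerCLM (M : Type*) [CStarAlgebra M] [PartialOrder M] [StarOrderedRing M]
    {F : Type*} [NormedAddCommGroup F] [NormedSpace ℂ F] [Module Mᵐᵒᵖ F] [CStarModule Mᵐᵒᵖ F]
    (g : F) : F →L[Mᵐᵒᵖ] M where
  toFun x := minner M g x
  map_add' := minner_add_right g
  map_smul' a x := minner_opSMul_right a g x
  cont := continuous_minner.comp (continuous_const.prodMk continuous_id)

@[simp] theorem minnerCLM_apply (g x : F) : minnerCLM M g x = minner M g x := rfl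

namespace AdjointableOp

theorem star_minner_apply (A : AdjointableOp M F) (x y : F) :
    minner M (star A x) y = minner M x (A y) := by
  rw [minner_star_apply, star_star]

theorem map_add (A : AdjointableOp M F) (x y : F) : A (x + y) = A x + A y := A.toCLM.map_add x y

theorem map_smul (A : AdjointableOp M F) (c : ℂ) (x : F) : A (c • x) = c • A x :=
  A.toCLM.map_smul c x

theorem map_opSMul (A : AdjointableOp M F) (a : Mᵐᵒᵖ) (x : F) : A (a • x) = a • A x :=
  minner_ext (M := M) fun z => by
    rw [← star_minner_apply, minner_opSMul_right, minner_opSMul_right, star_minner_apply]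

@[simp] theorem zero_apply (x : F) : (0 : AdjointableOp M F) x = 0 := rfl

theorem sum_apply {ι : Type*} (s : Finset ι) (A : ι → AdjointableOp M F) (x : F) :
    (∑ i ∈ s, A i) x = ∑ i ∈ s, A i x := by
  classical
  induction s using Finset.induction_on with
  | empty => simp
  | insert i s hi ih => rw [Finset.sum_insert hi, Finset.sum_insert hi, add_apply, ih]

/-- A unitary operator preserves inner products. -/
theorem minner_unitary {U : AdjointableOp M F} (hU : U ∈ unitary (AdjointableOp M F)) (x y : F) :
    minner M (U x) (U y) = minner M x y := by
  rw [minner_star_apply, ← mul_apply, (Unitary.mem_iff.1 hU).1, one_apply]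

end AdjointableOp

/-! ### Operators on a self-dual completion -/

/-- A map with the same Gram matrix as `t` extends to an `M`-linear map on the span of `t`. -/
theorem exists_linearMap_span_of_minner_eq {ι : Type*} {t s : ι → F}
    (h : ∀ p q, minner M (s p) (s q) = minner M (t p) (t q)) :
    ∃ V : Submodule.span Mᵐᵒᵖ (Set.range t) →ₗ[Mᵐᵒᵖ] F,
      (∀ p, V ⟨t p, Submodule.subset_span ⟨p, rfl⟩⟩ = s p) ∧ ∀ z, ‖V z‖ = ‖z‖ := by
  have hgram : ∀ c d : ι →₀ Mᵐᵒᵖ,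
      minner M (Finsupp.linearCombination Mᵐᵒᵖ s c) (Finsupp.linearCombination Mᵐᵒᵖ s d) =
        minner M (Finsupp.linearCombination Mᵐᵒᵖ t c) (Finsupp.linearCombination Mᵐᵒᵖ t d) := by
    intro c d
    induction c using Finsupp.induction_linear with
    | zero => simp
    | add c₁ c₂ h₁ h₂ =>
      rw [_root_.map_add, _root_.map_add, minner_add_left, minner_add_left, h₁, h₂]
    | single p a =>
      induction d using Finsupp.induction_linear with
      | zero => simp
      | add d₁ d₂ h₁ h₂ =>
        rw [_root_.map_add, _root_.map_add, minner_add_right, minner_add_right, h₁, h₂]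
      | single q b =>
        simp only [Finsupp.linearCombination_single, minner_opSMul_left, minner_opSMul_right, h]
  have hnorm : ∀ c : ι →₀ Mᵐᵒᵖ, ‖Finsupp.linearCombination Mᵐᵒᵖ s c‖ =
      ‖Finsupp.linearCombination Mᵐᵒᵖ t c‖ := fun c =>
    norm_eq_of_minner_self_eq (M := M) (hgram c c)
  have hsurj : ∀ z : Submodule.span Mᵐᵒᵖ (Set.range t),
      ∃ c, Finsupp.linearCombination Mᵐᵒᵖ t c = z := fun z =>
    LinearMap.mem_range.1 ((Finsupp.range_linearCombination Mᵐᵒᵖ (v := t)).ge z.2)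
  have hwd : ∀ c d : ι →₀ Mᵐᵒᵖ, Finsupp.linearCombination Mᵐᵒᵖ t c =
      Finsupp.linearCombination Mᵐᵒᵖ t d →
      Finsupp.linearCombination Mᵐᵒᵖ s c = Finsupp.linearCombination Mᵐᵒᵖ s d := fun c d hcd => by
    rw [← sub_eq_zero, ← _root_.map_sub, ← norm_eq_zero, hnorm, _root_.map_sub, hcd, sub_self,
      norm_zero]
  choose σ hσ using hsurj
  refine ⟨{ toFun := fun z => Finsupp.linearCombination Mᵐᵒᵖ s (σ z)
            map_add' := fun z z' => ?_
            map_smul' := fun a z => ?_ }, fun p => ?_, fun z => ?_⟩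
  · rw [← _root_.map_add]
    exact hwd _ _ (by rw [hσ, _root_.map_add, hσ, hσ, Submodule.coe_add])
  · rw [RingHom.id_apply, ← _root_.map_smul]
    exact hwd _ _ (by rw [hσ, _root_.map_smul, hσ, Submodule.coe_smul])
  · change Finsupp.linearCombination Mᵐᵒᵖ s _ = s p
    have h1 : s p = Finsupp.linearCombination Mᵐᵒᵖ s (Finsupp.single p 1) := by simp
    rw [h1]
    exact hwd _ _ (by rw [hσ]; simp)
  · change ‖Finsupp.linearCombination Mᵐᵒᵖ s _‖ = _
    rw [hnorm, hσ, Submodule.coe_norm]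

end HilbertModule

namespace WStarCorrespondence

variable {M : Type u} [CStarAlgebra M] [PartialOrder M] [StarOrderedRing M]
  {G : WStarCorrespondence.{u, v} M} {ι : Type*}

/-- `G` is the self-dual completion of the `M`-linear span of the family `t`: its elements
correspond to the bounded `M`-linear functionals on that span. -/
def IsSelfDualCompletion (G : WStarCorrespondence.{u, v} M) (t : ι → G) : Prop :=
  ∀ f : Submodule.span Mᵐᵒᵖ (Set.range t) →ₗ[Mᵐᵒᵖ] M,
    (∃ C : ℝ, ∀ z, ‖f z‖ ≤ C * ‖(z : G)‖) → ∃! g : G, ∀ z, f z = minner M g (z : G)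

namespace IsSelfDualCompletion

variable {t : ι → G} (ht : IsSelfDualCompletion G t)
include ht

/-- A bounded functional on `G` is determined by its values on the family: by self-duality it is an
inner product. -/
theorem functional_ext {f f' : G →L[Mᵐᵒᵖ] M} (h : ∀ p, f (t p) = f' (t p)) : f = f' := by
  obtain ⟨g, hg⟩ := G.selfDual f
  obtain ⟨g', hg'⟩ := G.selfDual f'
  have hz : ∀ z : Submodule.span Mᵐᵒᵖ (Set.range t), f (z : G) = f' (z : G) := fun z => by
    have hle : Submodule.span Mᵐᵒᵖ (Set.range t) ≤
        LinearMap.eqLocus (f : G →ₗ[Mᵐᵒᵖ] M) (f' : G →ₗ[Mᵐᵒᵖ] M) :=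
      Submodule.span_le.2 (by rintro _ ⟨p, rfl⟩; exact h p)
    exact hle z.2
  have hu := (ht ((minnerCLM M g : G →ₗ[Mᵐᵒᵖ] M).domRestrict _)
    ⟨‖g‖, fun z => norm_minner_le g (z : G)⟩).unique (y₁ := g) (y₂ := g') (fun z => rfl)
    (fun z => by
      change minner M g (z : G) = _
      rw [← hg, hz, hg'])
  ext x
  rw [hg, hg', hu]

theorem ext_left {g g' : G} (h : ∀ p, minner M g (t p) = minner M g' (t p)) : g = g' :=
  minner_ext_left (M := M) fun z =>
    congrArg (fun f : G →L[Mᵐᵒᵖ] M => f z)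
      (ht.functional_ext (f := minnerCLM M g) (f' := minnerCLM M g') h)

theorem ext_right {g g' : G} (h : ∀ p, minner M (t p) g = minner M (t p) g') : g = g' :=
  ht.ext_left fun p => by rw [← minner_star, h, minner_star]

theorem op_ext {A B : G.Op} (h : ∀ p, A (t p) = B (t p)) : A = B :=
  AdjointableOp.ext fun x => ht.ext_right fun p => by
    rw [← AdjointableOp.star_minner_apply, ← AdjointableOp.star_minner_apply]
    congr 1
    refine ht.ext_left fun q => ?_
    rw [AdjointableOp.star_minner_apply, AdjointableOp.star_minner_apply, h]

/-- If `s` has the same Gram matrix as the family `t`, the adjoint of `t p ↦ s p` is defined on all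
of `G`, by its inner products with the family. It is bounded by the closed graph theorem. -/
theorem exists_clm_minner_eq {s : ι → G}
    (hs : ∀ p q, minner M (s p) (s q) = minner M (t p) (t q)) :
    ∃ C : G →L[ℂ] G, (∀ g p, minner M (C g) (t p) = minner M g (s p)) ∧
      ∀ (a : Mᵐᵒᵖ) g, C (a • g) = a • C g := by
  obtain ⟨V, hV, hVn⟩ := exists_linearMap_span_of_minner_eq hs
  have hex : ∀ g : G, ∃ g' : G, ∀ p, minner M g' (t p) = minner M g (s p) := fun g => by
    obtain ⟨g', hg', -⟩ := ht ((minnerCLM M g : G →ₗ[Mᵐᵒᵖ] M).comp V)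
      ⟨‖g‖, fun z => (norm_minner_le g (V z)).trans (by rw [hVn]; rfl)⟩
    refine ⟨g', fun p => ?_⟩
    rw [← hV p]
    exact (hg' ⟨t p, _⟩).symm
  choose C hC using hex
  have hlin : IsLinearMap ℂ C :=
    { map_add := fun x y => ht.ext_left fun p => by
        rw [minner_add_left, hC, hC, hC, minner_add_left]
      map_smul := fun c x => ht.ext_left fun p => by
        rw [minner_smul_left, hC, hC, minner_smul_left] }
  have hcont : Continuous (hlin.mk' C) := by
    refine (hlin.mk' C).continuous_of_seq_closed_graph fun u x y hu hCu => ?_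
    refine ht.ext_left fun p => ?_
    have h1 := (continuous_minner (M := M) (F := G)).tendsto (y, t p) |>.comp
      (hCu.prodMk_nhds (tendsto_const_nhds (x := t p)))
    have h2 := (continuous_minner (M := M) (F := G)).tendsto (x, s p) |>.comp
      (hu.prodMk_nhds (tendsto_const_nhds (x := s p)))
    change _ = minner M (C x) (t p)
    rw [hC]
    exact tendsto_nhds_unique h1 (h2.congr fun n => (hC (u n) p).symm)
  exact ⟨⟨hlin.mk' C, hcont⟩, hC, fun a g => ht.ext_left fun p => by
    change minner M (C _) _ = minner M (a • C g) _
    rw [minner_opSMul_left, hC, hC, minner_opSMul_left]⟩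

/-- Two mutually adjoint maps that preserve the inner products of the family define an adjointable
operator on the completion. -/
theorem exists_op {s s' : ι → G}
    (hs : ∀ p q, minner M (s p) (s q) = minner M (t p) (t q))
    (hs' : ∀ p q, minner M (s' p) (s' q) = minner M (t p) (t q))
    (hadj : ∀ p q, minner M (s p) (t q) = minner M (t p) (s' q)) :
    ∃ A : G.Op, ∀ p, A (t p) = s p := by
  obtain ⟨C, hC, hCM⟩ := ht.exists_clm_minner_eq hs'
  obtain ⟨C', hC', hCM'⟩ := ht.exists_clm_minner_eq hs
  have hCt : ∀ p, C (t p) = s p := fun p => ht.ext_left fun q => by rw [hC, hadj]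
  have hCt' : ∀ p, C' (t p) = s' p := fun p => ht.ext_left fun q => by
    rw [hC', ← minner_star, hadj, minner_star]
  refine ⟨⟨C, C', fun x y => ?_⟩, hCt⟩
  let f' : G →L[Mᵐᵒᵖ] M :=
    { toFun := fun y => minner M x (C' y)
      map_add' := fun y y' => by rw [C'.map_add, minner_add_right]
      map_smul' := fun a y => by rw [hCM', minner_opSMul_right]; rfl
      cont := continuous_minner.comp (continuous_const.prodMk C'.continuous) }
  have := ht.functional_ext (f := minnerCLM M (C x)) (f' := f') fun p => by
    change minner M (C x) (t p) = minner M x (C' (t p))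
    rw [hC, hCt']
  exact congrArg (fun f : G →L[Mᵐᵒᵖ] M => f y) this

end IsSelfDualCompletion

end WStarCorrespondence

theorem Commute.ringInverse_of_commute {R : Type*} [MonoidWithZero R] {a b : R} (h : Commute a b) :
    Commute (Ring.inverse a) b := by
  by_cases ha : IsUnit a
  · obtain ⟨a, rfl⟩ := ha
    rw [Ring.inverse_unit]
    exact h.units_inv_left
  · rw [Ring.inverse_non_unit a ha]
    exact Commute.zero_left b

namespace TensorPowers

variable {M : Type u} [CStarAlgebra M] [PartialOrder M] [StarOrderedRing M]
  {E : WStarCorrespondence.{u, v} M} (T : TensorPowers.{u, v, w} E)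

/-! ### Elementary tensors -/

section tmul

variable {l m n : ℕ} (h : l + m = n)
include h

theorem isSelfDualCompletion : WStarCorrespondence.IsSelfDualCompletion (T.pow n)
    (fun p : T.pow l × T.pow m => T.tmul h p.1 p.2) :=
  (T.isTensorProduct h).existsUnique_dual

theorem minner_tmul (x x' : T.pow l) (y y' : T.pow m) :
    minner M (T.tmul h x y) (T.tmul h x' y') =
      minner M y ((T.pow m).left (minner M x x') y') :=
  (T.isTensorProduct h).inner_tmul x x' y y'

theorem op_ext {A B : (T.pow n).Op} (hAB : ∀ x y, A (T.tmul h x y) = B (T.tmul h x y)) : A = B :=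
  (T.isSelfDualCompletion h).op_ext fun p => hAB p.1 p.2

theorem ext_right {g g' : T.pow n}
    (hg : ∀ x y, minner M (T.tmul h x y) g = minner M (T.tmul h x y) g') : g = g' :=
  (T.isSelfDualCompletion h).ext_right fun p => hg p.1 p.2

theorem add_tmul (x x' : T.pow l) (y : T.pow m) :
    T.tmul h (x + x') y = T.tmul h x y + T.tmul h x' y :=
  T.ext_right h fun a b => by
    simp only [minner_tmul, minner_add_right, map_add, AdjointableOp.add_apply]

theorem tmul_add (x : T.pow l) (y y' : T.pow m) :
    T.tmul h x (y + y') = T.tmul h x y + T.tmul h x y' :=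
  T.ext_right h fun a b => by
    simp only [minner_tmul, minner_add_right, AdjointableOp.map_add]

theorem smul_tmul (c : ℂ) (x : T.pow l) (y : T.pow m) :
    T.tmul h (c • x) y = c • T.tmul h x y :=
  T.ext_right h fun a b => by
    simp only [minner_tmul, minner_smul_right, map_smul, AdjointableOp.smul_apply]

theorem tmul_smul (c : ℂ) (x : T.pow l) (y : T.pow m) :
    T.tmul h x (c • y) = c • T.tmul h x y :=
  T.ext_right h fun a b => by
    simp only [minner_tmul, minner_smul_right, AdjointableOp.map_smul]

theorem tmul_opSMul (a : Mᵐᵒᵖ) (x : T.pow l) (y : T.pow m) :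
    T.tmul h x (a • y) = a • T.tmul h x y :=
  T.ext_right h fun _ _ => by
    simp only [minner_tmul, minner_opSMul_right, AdjointableOp.map_opSMul]

/-- Elementary tensors are balanced over `M`. -/
theorem opSMul_tmul (a : M) (x : T.pow l) (y : T.pow m) :
    T.tmul h (op a • x) y = T.tmul h x ((T.pow m).left a y) :=
  T.ext_right h fun _ _ => by
    simp only [minner_tmul, minner_opSMul_right, op_smul_eq_mul, map_mul,
      AdjointableOp.mul_apply]

theorem norm_tmul_le (x : T.pow l) (y : T.pow m) : ‖T.tmul h x y‖ ≤ ‖x‖ * ‖y‖ := by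
  refine le_of_sq_le_sq ?_ (by positivity)
  rw [norm_sq_minner (M := M), minner_tmul]
  calc _ ≤ ‖y‖ * ‖(T.pow m).left (minner M x x) y‖ := norm_minner_le _ _
    _ ≤ ‖y‖ * (‖minner M x x‖ * ‖y‖) := by
        gcongr
        refine (AdjointableOp.norm_apply_le _ _).trans ?_
        gcongr
        exact NonUnitalStarAlgHom.norm_apply_le (T.pow m).left _
    _ = _ := by rw [← norm_sq_minner]; ring

end tmul

/-! ### The commutant of the left action -/

/-- The relative commutant of the left action, as a `*`-subalgebra. -/
noncomputable def commutant (k : ℕ) : StarSubalgebra ℂ (T.pow k).Op :=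
  StarSubalgebra.centralizer ℂ (Set.range (T.pow k).left)

theorem mem_commutant_iff {k : ℕ} {A : (T.pow k).Op} :
    A ∈ T.commutant k ↔ A ∈ (T.pow k).leftCommutant := by
  rw [commutant, StarSubalgebra.mem_centralizer_iff]
  constructor
  · exact fun h a => ((h _ ⟨a, rfl⟩).1).symm
  · rintro h _ ⟨a, rfl⟩
    refine ⟨(h a).symm, ?_⟩
    rw [← map_star]
    exact (h _).symm

theorem apply_left_of_mem_commutant {k : ℕ} {A : (T.pow k).Op} (hA : A ∈ T.commutant k) (a : M)
    (x : T.pow k) : A ((T.pow k).left a x) = (T.pow k).left a (A x) :=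
  congrArg (fun B : (T.pow k).Op => B x) (T.mem_commutant_iff.1 hA a)

theorem isClosed_commutant (k : ℕ) : IsClosed (T.commutant k : Set (T.pow k).Op) := by
  rw [commutant, StarSubalgebra.coe_centralizer]
  exact Set.isClosed_centralizer _

theorem sqrt_mem_commutant {k : ℕ} {A : (T.pow k).Op} (hA : A ∈ T.commutant k) :
    CFC.sqrt A ∈ T.commutant k := by
  refine T.mem_commutant_iff.2 fun a => ?_
  rw [CFC.sqrt_eq_cfc]
  exact (Commute.cfc_nnreal (T.mem_commutant_iff.1 hA a) _).eq

theorem inverse_mem_commutant {k : ℕ} {A : (T.pow k).Op} (hA : A ∈ T.commutant k) :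
    Ring.inverse A ∈ T.commutant k :=
  T.mem_commutant_iff.2 fun a =>
    Commute.ringInverse_of_commute (T.mem_commutant_iff.1 hA a)

/-! ### Tensor products of operators -/

section tensorOp

variable {l m n : ℕ} (h : l + m = n)
include h

/-- On unitaries, `A ⊗ B` preserves the inner products of elementary tensors. -/
theorem exists_tensorOp_of_unitary {A : (T.pow l).Op} {B : (T.pow m).Op}
    (hA : A ∈ unitary (T.pow l).Op) (hB : B ∈ unitary (T.pow m).Op) (hBc : B ∈ T.commutant m) :
    ∃ C : (T.pow n).Op, ∀ x y, C (T.tmul h x y) = T.tmul h (A x) (B y) := by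
  have key : ∀ {A : (T.pow l).Op} {B : (T.pow m).Op}, A ∈ unitary (T.pow l).Op →
      B ∈ unitary (T.pow m).Op → B ∈ T.commutant m → ∀ x x' y y',
      minner M (T.tmul h (A x) (B y)) (T.tmul h (A x') (B y')) =
        minner M (T.tmul h x y) (T.tmul h x' y') := fun hA hB hBc x x' y y' => by
    rw [minner_tmul, minner_tmul, AdjointableOp.minner_unitary hA,
      ← T.apply_left_of_mem_commutant hBc, AdjointableOp.minner_unitary hB]
  obtain ⟨C, hC⟩ := (T.isSelfDualCompletion h).exists_op
    (s := fun p => T.tmul h (A p.1) (B p.2))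
    (s' := fun p => T.tmul h (star A p.1) (star B p.2))
    (fun p q => key hA hB hBc p.1 q.1 p.2 q.2)
    (fun p q => key (Unitary.star_mem hA) (Unitary.star_mem hB) (star_mem hBc) p.1 q.1 p.2 q.2)
    (fun p q => by
      rw [minner_tmul, minner_tmul, AdjointableOp.minner_star_apply,
        AdjointableOp.minner_star_apply, T.apply_left_of_mem_commutant (star_mem hBc)])
  exact ⟨C, fun x y => hC (x, y)⟩

/-- `A ⊗ B` exists for every `A` and every `B` in the commutant of the left action, since both are
linear combinations of unitaries. -/
theorem exists_tensorOp (A : (T.pow l).Op) {B : (T.pow m).Op} (hB : B ∈ T.commutant m) :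
    ∃ C : (T.pow n).Op, ∀ x y, C (T.tmul h x y) = T.tmul h (A x) (B y) := by
  have : IsClosed (T.commutant m : Set (T.pow m).Op) := T.isClosed_commutant m
  have hspan : ∀ B' : T.commutant m,
      ∃ C : (T.pow n).Op, ∀ x y, C (T.tmul h x y) = T.tmul h (A x) ((B' : (T.pow m).Op) y) := by
    intro B'
    have hB' : B' ∈ Submodule.span ℂ (unitary (T.commutant m) : Set (T.commutant m)) := by
      rw [CStarAlgebra.span_unitary]; trivial
    induction hB' using Submodule.span_induction with
    | mem U hU =>
      have hU' : (U : (T.pow m).Op) ∈ unitary (T.pow m).Op := by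
        have h1 := Unitary.mem_iff.1 hU
        exact Unitary.mem_iff.2 ⟨congrArg Subtype.val h1.1, congrArg Subtype.val h1.2⟩
      have hA : A ∈ Submodule.span ℂ (unitary (T.pow l).Op : Set (T.pow l).Op) := by
        rw [CStarAlgebra.span_unitary]; trivial
      induction hA using Submodule.span_induction with
      | mem A hA => exact T.exists_tensorOp_of_unitary h hA hU' U.2
      | zero => exact ⟨0, fun x y => by simpa using (T.smul_tmul h 0 0 (U.1 y)).symm⟩
      | add A₁ A₂ _ _ h₁ h₂ =>
        obtain ⟨C₁, h₁⟩ := h₁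
        obtain ⟨C₂, h₂⟩ := h₂
        exact ⟨C₁ + C₂, fun x y => by
          rw [AdjointableOp.add_apply, AdjointableOp.add_apply, h₁, h₂, add_tmul]⟩
      | smul c A _ h₁ =>
        obtain ⟨C₁, h₁⟩ := h₁
        exact ⟨c • C₁, fun x y => by
          rw [AdjointableOp.smul_apply, AdjointableOp.smul_apply, h₁, smul_tmul]⟩
    | zero => exact ⟨0, fun x y => by simpa using (T.tmul_smul h 0 (A x) 0).symm⟩
    | add B₁ B₂ _ _ h₁ h₂ =>
      obtain ⟨C₁, h₁⟩ := h₁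
      obtain ⟨C₂, h₂⟩ := h₂
      refine ⟨C₁ + C₂, fun x y => ?_⟩
      rw [AdjointableOp.add_apply, h₁, h₂, ← tmul_add]
      rfl
    | smul c B₁ _ h₁ =>
      obtain ⟨C₁, h₁⟩ := h₁
      refine ⟨c • C₁, fun x y => ?_⟩
      rw [AdjointableOp.smul_apply, h₁, ← tmul_smul]
      rfl
  exact hspan ⟨B, hB⟩

theorem tensorOp_tmul (A : (T.pow l).Op) {B : (T.pow m).Op} (hB : B ∈ T.commutant m)
    (x : T.pow l) (y : T.pow m) : T.tensorOp h A B (T.tmul h x y) = T.tmul h (A x) (B y) := by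
  have hC := T.exists_tensorOp h A hB
  rw [tensorOp, dif_pos hC]
  exact hC.choose_spec x y

theorem tensorOp_mem_commutant {A : (T.pow l).Op} {B : (T.pow m).Op} (hA : A ∈ T.commutant l)
    (hB : B ∈ T.commutant m) : T.tensorOp h A B ∈ T.commutant n :=
  T.mem_commutant_iff.2 fun a => T.op_ext h fun x y => by
    rw [AdjointableOp.mul_apply, AdjointableOp.mul_apply, (T.isTensorProduct h).left_tmul,
      T.tensorOp_tmul h A hB, T.tensorOp_tmul h A hB, (T.isTensorProduct h).left_tmul,
      T.apply_left_of_mem_commutant hA]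

theorem tensorOp_mul (A A' : (T.pow l).Op) {B B' : (T.pow m).Op} (hB : B ∈ T.commutant m)
    (hB' : B' ∈ T.commutant m) :
    T.tensorOp h (A * A') (B * B') = T.tensorOp h A B * T.tensorOp h A' B' :=
  T.op_ext h fun x y => by
    rw [AdjointableOp.mul_apply, T.tensorOp_tmul h _ (mul_mem hB hB'), T.tensorOp_tmul h _ hB',
      T.tensorOp_tmul h _ hB]
    rfl

theorem tensorOp_one_one : T.tensorOp h (1 : (T.pow l).Op) (1 : (T.pow m).Op) = 1 :=
  T.op_ext h fun x y => by rw [T.tensorOp_tmul h _ (one_mem _)]; rfl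

theorem star_tensorOp (A : (T.pow l).Op) {B : (T.pow m).Op} (hB : B ∈ T.commutant m) :
    star (T.tensorOp h A B) = T.tensorOp h (star A) (star B) :=
  T.op_ext h fun x y => T.ext_right h fun x' y' => by
    rw [← AdjointableOp.minner_star_apply, T.tensorOp_tmul h _ hB,
      T.tensorOp_tmul h _ (star_mem hB), minner_tmul, minner_tmul,
      AdjointableOp.minner_star_apply, AdjointableOp.minner_star_apply,
      T.apply_left_of_mem_commutant (star_mem hB)]

theorem tensorOp_smul_left (c : ℂ) (A : (T.pow l).Op) {B : (T.pow m).Op} (hB : B ∈ T.commutant m) :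
    T.tensorOp h (c • A) B = c • T.tensorOp h A B :=
  T.op_ext h fun x y => by
    rw [AdjointableOp.smul_apply, T.tensorOp_tmul h _ hB, T.tensorOp_tmul h _ hB, ← smul_tmul]
    rfl

theorem tensorOp_smul_right (c : ℂ) (A : (T.pow l).Op) {B : (T.pow m).Op}
    (hB : B ∈ T.commutant m) : T.tensorOp h A (c • B) = c • T.tensorOp h A B :=
  T.op_ext h fun x y => by
    rw [AdjointableOp.smul_apply, T.tensorOp_tmul h _ ((T.commutant m).smul_mem hB c),
      T.tensorOp_tmul h _ hB, ← tmul_smul]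
    rfl

theorem tensorOp_sub_left (A A' : (T.pow l).Op) {B : (T.pow m).Op} (hB : B ∈ T.commutant m) :
    T.tensorOp h (A - A') B = T.tensorOp h A B - T.tensorOp h A' B := by
  rw [eq_sub_iff_add_eq]
  exact T.op_ext h fun x y => by
    rw [AdjointableOp.add_apply, T.tensorOp_tmul h _ hB, T.tensorOp_tmul h _ hB,
      T.tensorOp_tmul h _ hB, ← add_tmul, ← AdjointableOp.add_apply, sub_add_cancel]

theorem tensorOp_add_right (A : (T.pow l).Op) {B B' : (T.pow m).Op} (hB : B ∈ T.commutant m)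
    (hB' : B' ∈ T.commutant m) :
    T.tensorOp h A (B + B') = T.tensorOp h A B + T.tensorOp h A B' :=
  T.op_ext h fun x y => by
    rw [AdjointableOp.add_apply, T.tensorOp_tmul h _ hB, T.tensorOp_tmul h _ hB',
      T.tensorOp_tmul h _ (add_mem hB hB'), ← tmul_add]
    rfl

theorem tensorOp_zero_right (A : (T.pow l).Op) : T.tensorOp h A (0 : (T.pow m).Op) = 0 := by
  simpa using T.tensorOp_smul_right h 0 A (zero_mem (T.commutant m))

theorem tensorOp_sum_right {ι : Type*} (s : Finset ι) (A : (T.pow l).Op) (B : ι → (T.pow m).Op)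
    (hB : ∀ i ∈ s, B i ∈ T.commutant m) :
    T.tensorOp h A (∑ i ∈ s, B i) = ∑ i ∈ s, T.tensorOp h A (B i) := by
  classical
  induction s using Finset.induction_on with
  | empty => simp [tensorOp_zero_right]
  | insert i s hi ih =>
    rw [Finset.sum_insert hi, Finset.sum_insert hi, T.tensorOp_add_right h A
      (hB i (Finset.mem_insert_self i s))
      (sum_mem fun j hj => hB j (Finset.mem_insert_of_mem hj)),
      ih fun j hj => hB j (Finset.mem_insert_of_mem hj)]

theorem tensorOp_nonneg {A : (T.pow l).Op} {B : (T.pow m).Op} (hA : 0 ≤ A) (hB : 0 ≤ B)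
    (hBc : B ∈ T.commutant m) : 0 ≤ T.tensorOp h A B := by
  have hs := T.sqrt_mem_commutant hBc
  have h1 : T.tensorOp h A B =
      star (T.tensorOp h (CFC.sqrt A) (CFC.sqrt B)) * T.tensorOp h (CFC.sqrt A) (CFC.sqrt B) := by
    rw [T.star_tensorOp h _ hs, (CFC.sqrt_nonneg A).isSelfAdjoint.star_eq,
      (CFC.sqrt_nonneg B).isSelfAdjoint.star_eq, ← T.tensorOp_mul h _ _ hs hs,
      CFC.sqrt_mul_sqrt_self A, CFC.sqrt_mul_sqrt_self B]
  rw [h1]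
  exact star_mul_self_nonneg _

theorem tensorOp_mono_left {A A' : (T.pow l).Op} {B : (T.pow m).Op} (hA : A ≤ A') (hB : 0 ≤ B)
    (hBc : B ∈ T.commutant m) : T.tensorOp h A B ≤ T.tensorOp h A' B := by
  rw [← sub_nonneg, ← T.tensorOp_sub_left h _ _ hBc]
  exact T.tensorOp_nonneg h (sub_nonneg.2 hA) hB hBc

theorem tensorOp_mono_right {A : (T.pow l).Op} {B B' : (T.pow m).Op} (hA : 0 ≤ A) (hB : B ≤ B')
    (hBc : B ∈ T.commutant m) (hBc' : B' ∈ T.commutant m) :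
    T.tensorOp h A B ≤ T.tensorOp h A B' := by
  rw [← sub_nonneg]
  have h1 := T.tensorOp_nonneg h hA (sub_nonneg.2 hB) (sub_mem hBc' hBc)
  have h2 := T.tensorOp_add_right h A (sub_mem hBc' hBc) hBc
  rw [sub_add_cancel] at h2
  rwa [h2, add_sub_cancel_right]

end tensorOp

/-- The functional `y ↦ ⟪g, x ⊗ y⟫`. -/
noncomputable def minnerTmulCLM {l m n : ℕ} (h : l + m = n) (g : T.pow n) (x : T.pow l) :
    T.pow m →L[Mᵐᵒᵖ] M where
  toFun y := minner M g (T.tmul h x y)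
  map_add' y y' := by rw [tmul_add, minner_add_right]
  map_smul' a y := by rw [tmul_opSMul, minner_opSMul_right, RingHom.id_apply]
  cont := by
    let f : T.pow m →ₗ[ℂ] M :=
      { toFun := fun y => minner M g (T.tmul h x y)
        map_add' := fun y y' => by rw [tmul_add, minner_add_right]
        map_smul' := fun c y => by rw [tmul_smul, minner_smul_right, RingHom.id_apply] }
    refine (f.mkContinuous (‖g‖ * ‖x‖) fun y => ?_).continuous
    rw [mul_assoc]
    exact (norm_minner_le _ _).trans (by gcongr; exact T.norm_tmul_le h x y)

/-- Associativity of the tensor product of operators. Threefold elementary tensors determine an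
operator because `w ↦ ⟪g, x ⊗ w⟫` is bounded and `M`-linear. -/
theorem tensorOp_assoc {l m n p q r : ℕ} (h₁ : l + m = p) (h₂ : p + n = q) (h₃ : m + n = r)
    (h₄ : l + r = q) (A : (T.pow l).Op) {B : (T.pow m).Op} {C : (T.pow n).Op}
    (hB : B ∈ T.commutant m) (hC : C ∈ T.commutant n) :
    T.tensorOp h₂ (T.tensorOp h₁ A B) C = T.tensorOp h₄ A (T.tensorOp h₃ B C) := by
  refine T.op_ext h₄ fun x w => minner_ext (M := M) fun k => ?_
  rw [← AdjointableOp.star_minner_apply, ← AdjointableOp.star_minner_apply]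
  have := (T.isSelfDualCompletion h₃).functional_ext
    (f := T.minnerTmulCLM h₄ (star (T.tensorOp h₂ (T.tensorOp h₁ A B) C) k) x)
    (f' := T.minnerTmulCLM h₄ (star (T.tensorOp h₄ A (T.tensorOp h₃ B C)) k) x) fun yz => by
      change minner M _ (T.tmul h₄ x (T.tmul h₃ yz.1 yz.2)) =
        minner M _ (T.tmul h₄ x (T.tmul h₃ yz.1 yz.2))
      rw [AdjointableOp.star_minner_apply, AdjointableOp.star_minner_apply,
        T.tensorOp_tmul h₄ _ (T.tensorOp_mem_commutant h₃ hB hC), T.tensorOp_tmul h₃ _ hC,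
        ← T.tmul_assoc h₁ h₂ h₃ h₄, ← T.tmul_assoc h₁ h₂ h₃ h₄, T.tensorOp_tmul h₂ _ hC,
        T.tensorOp_tmul h₁ _ hB]
  exact congrArg (fun f : T.pow r →L[Mᵐᵒᵖ] M => f w) this

end TensorPowers

/-! ### Quotients of commuting positive elements -/

section CStarAlgebra

variable {A : Type*} [CStarAlgebra A] [PartialOrder A] [StarOrderedRing A]

theorem Commute.cfcSqrt_cfcSqrt {a b : A} (h : Commute a b) :
    Commute (CFC.sqrt a) (CFC.sqrt b) := by
  rw [CFC.sqrt_eq_cfc, CFC.sqrt_eq_cfc]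
  exact ((h.cfc_nnreal _).symm.cfc_nnreal _).symm

/-- Operator monotonicity of the square root. -/
theorem le_of_mul_self_le_mul_self_of_nonneg {a b : A} (ha : 0 ≤ a) (hb : 0 ≤ b)
    (h : a * a ≤ b * b) : a ≤ b := by
  have := CFC.sqrt_le_sqrt _ _ h
  rwa [CFC.sqrt_mul_self a, CFC.sqrt_mul_self b] at this

theorem ringInverse_nonneg {p : A} (hp : 0 ≤ p) : 0 ≤ Ring.inverse p := by
  by_cases hu : IsUnit p
  · exact (CFC.ringInverse_nonneg_iff_nonneg_of_isUnit hu).2 hp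
  · rw [Ring.inverse_non_unit p hu]

theorem ringInverse_mul_nonneg {p q : A} (hp : 0 ≤ p) (hq : 0 ≤ q) (h : Commute p q) :
    0 ≤ Ring.inverse p * q :=
  h.ringInverse_of_commute.mul_nonneg (ringInverse_nonneg hp) hq

theorem sqrt_smul_mul_self {c : ℝ} (hc : 0 ≤ c) (q : A) :
    (√c • q) * (√c • q) = c • (q * q) := by
  rw [smul_mul_smul_comm, Real.mul_self_sqrt hc]

theorem le_ringInverse_mul {p q : A} (hp : 0 ≤ p) (hu : IsUnit p) (hq : 0 ≤ q) (h : Commute p q)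
    {c : ℝ} (hc : 0 < c) (hle : p * p ≤ c • (q * q)) : (√c)⁻¹ • (1 : A) ≤ Ring.inverse p * q := by
  have h0 : 0 ≤ √c • q := smul_nonneg (Real.sqrt_nonneg c) hq
  have h1 : p ≤ √c • q := le_of_mul_self_le_mul_self_of_nonneg hp h0
    (by rwa [sqrt_smul_mul_self hc.le])
  have h2 : 0 ≤ Ring.inverse p * (√c • q - p) :=
    ringInverse_mul_nonneg hp (sub_nonneg.2 h1) ((h.smul_right _).sub_right (Commute.refl p))
  rw [mul_sub, Ring.inverse_mul_cancel p hu, sub_nonneg, mul_smul_comm] at h2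
  have h3 := smul_le_smul_of_nonneg_left h2 (inv_nonneg.2 (Real.sqrt_nonneg c))
  rwa [smul_smul, inv_mul_cancel₀ (Real.sqrt_pos.2 hc).ne', one_smul] at h3

theorem ringInverse_mul_le {p q : A} (hp : 0 ≤ p) (hu : IsUnit p) (hq : 0 ≤ q) (h : Commute p q)
    {c : ℝ} (hc : 0 < c) (hle : c • (q * q) ≤ p * p) : Ring.inverse p * q ≤ (√c)⁻¹ • (1 : A) := by
  have h0 : 0 ≤ √c • q := smul_nonneg (Real.sqrt_nonneg c) hq
  have h1 : √c • q ≤ p := le_of_mul_self_le_mul_self_of_nonneg h0 hp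
    (by rwa [sqrt_smul_mul_self hc.le])
  have h2 : 0 ≤ Ring.inverse p * (p - √c • q) :=
    ringInverse_mul_nonneg hp (sub_nonneg.2 h1) ((Commute.refl p).sub_right (h.smul_right _))
  rw [mul_sub, Ring.inverse_mul_cancel p hu, sub_nonneg, mul_smul_comm] at h2
  have h3 := smul_le_smul_of_nonneg_left h2 (inv_nonneg.2 (Real.sqrt_nonneg c))
  rwa [smul_smul, inv_mul_cancel₀ (Real.sqrt_pos.2 hc).ne', one_smul] at h3

theorem norm_ringInverse_mul_le {p q : A} (hp : 0 ≤ p) (hu : IsUnit p) (hq : 0 ≤ q)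
    (h : Commute p q) {c : ℝ} (hc : 0 < c) (hle : c • (q * q) ≤ p * p) :
    ‖Ring.inverse p * q‖ ≤ (√c)⁻¹ := by
  have h1 := ringInverse_mul_le hp hu hq h hc hle
  rw [← Algebra.algebraMap_eq_smul_one] at h1
  exact (CStarAlgebra.norm_le_iff_le_algebraMap _ (inv_nonneg.2 (Real.sqrt_nonneg c))
    (ringInverse_mul_nonneg hp hq h)).2 h1

end CStarAlgebra

/-! ### A root test -/

/-- If `limsup ‖x_k‖^{1/k} < a`, then the partial sums of `∑ ‖x_{i+1}‖ / a^i` are bounded. -/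
theorem exists_sum_norm_div_pow_le {A : ℕ → Type*} [∀ k, NormedRing (A k)] (x : ∀ k, A k) {a : ℝ}
    (ha : 0 < a)
    (h : limsup (fun k : ℕ => ‖x k‖ₑ ^ ((k : ℝ)⁻¹)) atTop < ENNReal.ofReal a) :
    ∃ C : ℝ, 0 < C ∧ ∀ m, ∑ i ∈ Finset.range m, ‖x (i + 1)‖ / a ^ i ≤ C := by
  obtain ⟨b, hb, hba⟩ := exists_between h
  lift b to NNReal using (hba.trans ENNReal.ofReal_lt_top).ne
  have hba' : (b : ℝ) < a := by
    rwa [ENNReal.ofReal, ENNReal.coe_lt_coe, Real.lt_toNNReal_iff_coe_lt] at hba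
  have hev : ∀ᶠ i : ℕ in atTop, ‖‖x (i + 1)‖ / a ^ i‖ ≤ b * (b / a) ^ i := by
    have h1 := (tendsto_add_atTop_nat 1).eventually (eventually_lt_of_limsup_lt hb)
    filter_upwards [h1] with i hi
    have h2 : ‖x (i + 1)‖ₑ ≤ (b : ℝ≥0∞) ^ (i + 1) := by
      have h3 := ENNReal.rpow_le_rpow hi.le (Nat.cast_nonneg (α := ℝ) (i + 1))
      rwa [← ENNReal.rpow_mul, inv_mul_cancel₀ (by positivity), ENNReal.rpow_one,
        ENNReal.rpow_natCast] at h3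
    have h4 : ‖x (i + 1)‖ ≤ (b : ℝ) ^ (i + 1) := by
      rw [← ENNReal.coe_pow, enorm_le_coe] at h2
      exact_mod_cast h2
    rw [Real.norm_of_nonneg (by positivity), div_pow, mul_div_assoc', ← pow_succ']
    gcongr
  have hsum : Summable fun i : ℕ => ‖x (i + 1)‖ / a ^ i := by
    refine Summable.of_norm_bounded_eventually_nat ?_ hev
    exact (summable_geometric_of_lt_one (by positivity) ((div_lt_one ha).2 hba')).mul_left _
  -- `+ 1` makes the bound strictly positive
  refine ⟨(∑' i, ‖x (i + 1)‖ / a ^ i) + 1, ?_, fun m => ?_⟩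
  · have : 0 ≤ ∑' i, ‖x (i + 1)‖ / a ^ i := tsum_nonneg fun i => by positivity
    linarith
  · have := hsum.sum_le_tsum (Finset.range m) fun i _ => by positivity
    linarith

/-! ### The sums over compositions -/

namespace Composition

/-- The composition of `m + 1` whose first block is `i + 1`, followed by a given composition of
`m - i`. -/
def consBlock {m : ℕ} (p : Σ i : Fin (m + 1), Composition (m - i)) : Composition (m + 1) where
  blocks := (p.1 + 1) :: p.2.blocks
  blocks_pos {j} hj := by
    rcases List.mem_cons.1 hj with rfl | hj
    · exact Nat.succ_pos _
    · exact p.2.blocks_pos hj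
  blocks_sum := by
    rw [List.sum_cons, p.2.blocks_sum]
    have := p.1.2
    omega

theorem consBlock_bijective (m : ℕ) : Function.Bijective (consBlock (m := m)) := by
  constructor
  · rintro ⟨i, c⟩ ⟨j, d⟩ h
    have h1 := List.cons.inj (congrArg Composition.blocks h)
    obtain rfl : i = j := Fin.ext (Nat.succ_injective h1.1)
    obtain rfl : c = d := Composition.ext h1.2
    rfl
  · rintro ⟨_ | ⟨a, c⟩, hpos, hsum⟩
    · simp at hsum
    · have ha : 0 < a := hpos List.mem_cons_self
      rw [List.sum_cons] at hsum
      refine ⟨⟨⟨a - 1, by omega⟩, ⟨c, fun hi => hpos (List.mem_cons_of_mem _ hi), by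
        change c.sum = m - (a - 1); omega⟩⟩, ?_⟩
      refine Composition.ext ?_
      change (a - 1 + 1) :: c = a :: c
      rw [Nat.sub_add_cancel ha]

theorem eq_ones_zero (c : Composition 0) : c = Composition.ones 0 := by
  refine Composition.ext (List.eq_nil_iff_forall_not_mem.2 fun a ha => ?_)
  exact (c.blocks_pos ha).ne' (Nat.le_zero.1 (c.blocks_sum ▸ List.le_sum_of_mem ha))

end Composition

namespace TensorPowers

variable {M : Type u} [CStarAlgebra M] [PartialOrder M] [StarOrderedRing M]
  {E : WStarCorrespondence.{u, v} M} (T : TensorPowers.{u, v, w} E) (X : T.OpSeq)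

/-- The sum of `X_{c₁} ⊗ ⋯ ⊗ X_{c_l}` over all compositions `c` of `k`; it is `R_k²`. -/
noncomputable def compositionSum (k : ℕ) : (T.pow k).Op :=
  ∑ c : Composition k, T.tensorList X c.blocks c.blocks_sum

theorem tensorOp_tensorList {l m n : ℕ} (h : l + m = n) (A : (T.pow l).Op) (c : List ℕ)
    (hc : c.sum = m) (h' : l + c.sum = n) :
    T.tensorOp h' A (T.tensorList X c rfl) = T.tensorOp h A (T.tensorList X c hc) := by
  subst hc
  rfl

theorem compositionSum_zero : T.compositionSum X 0 = 1 := by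
  rw [compositionSum, Fintype.sum_eq_single (Composition.ones 0) fun c hc =>
    (hc (Composition.eq_ones_zero c)).elim]
  rfl

variable {X} (hX : T.IsAdmissible X)
include hX

theorem tensorList_mem_commutant (c : List ℕ) (hc : ∀ a ∈ c, 1 ≤ a) {n : ℕ} (h : c.sum = n) :
    T.tensorList X c h ∈ T.commutant n := by
  induction c generalizing n with
  | nil => exact one_mem _
  | cons a c ih =>
    exact T.tensorOp_mem_commutant _
      (T.mem_commutant_iff.2 (hX.mem_commutant a (hc a List.mem_cons_self)))
      (ih (fun b hb => hc b (List.mem_cons_of_mem _ hb)) rfl)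

theorem tensorList_nonneg (c : List ℕ) (hc : ∀ a ∈ c, 1 ≤ a) {n : ℕ} (h : c.sum = n) :
    0 ≤ T.tensorList X c h := by
  induction c generalizing n with
  | nil => exact zero_le_one
  | cons a c ih =>
    have hc' : ∀ b ∈ c, 1 ≤ b := fun b hb => hc b (List.mem_cons_of_mem _ hb)
    exact T.tensorOp_nonneg _ (hX.nonneg a (hc a List.mem_cons_self)) (ih hc' rfl)
      (T.tensorList_mem_commutant hX c hc' rfl)

theorem compositionSum_mem_commutant (k : ℕ) : T.compositionSum X k ∈ T.commutant k :=
  sum_mem fun c _ => T.tensorList_mem_commutant hX _ (fun _ ha => c.blocks_pos ha) _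

theorem compositionSum_nonneg (k : ℕ) : 0 ≤ T.compositionSum X k :=
  Finset.sum_nonneg fun c _ => T.tensorList_nonneg hX _ (fun _ ha => c.blocks_pos ha) _

theorem R_mem_commutant (k : ℕ) : T.R X k ∈ T.commutant k :=
  T.sqrt_mem_commutant (T.compositionSum_mem_commutant hX k)

omit hX in
theorem R_nonneg (k : ℕ) : 0 ≤ T.R X k := CFC.sqrt_nonneg _

theorem R_mul_self (k : ℕ) : T.R X k * T.R X k = T.compositionSum X k :=
  CFC.sqrt_mul_sqrt_self _ (T.compositionSum_nonneg hX k)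

omit hX in
theorem R_zero : T.R X 0 = 1 := by
  change CFC.sqrt (T.compositionSum X 0) = 1
  rw [compositionSum_zero, CFC.sqrt_one]

/-- Compositions are sorted by their first block. -/
theorem compositionSum_succ (m : ℕ) :
    T.compositionSum X (m + 1) = ∑ i : Fin (m + 1),
      T.tensorOp (by omega : (i + 1 : ℕ) + (m - i) = m + 1) (X (i + 1))
        (T.compositionSum X (m - i)) := by
  rw [compositionSum, ← (Composition.consBlock_bijective m).sum_comp
    (fun c => T.tensorList X c.blocks c.blocks_sum), Fintype.sum_sigma]
  refine Finset.sum_congr rfl fun i _ => ?_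
  rw [compositionSum, T.tensorOp_sum_right _ _ _ _ fun c _ =>
    T.tensorList_mem_commutant hX _ (fun _ ha => c.blocks_pos ha) _]
  refine Finset.sum_congr rfl fun c _ => ?_
  exact T.tensorOp_tensorList X _ _ _ _ _

theorem tensorOp_one_compositionSum_le (m : ℕ) :
    T.tensorOp (Nat.add_comm 1 m) (X 1) (T.compositionSum X m) ≤ T.compositionSum X (m + 1) := by
  have hfirst : ∀ (j k : ℕ) (_ : j = 1) (_ : k = m) (h : j + k = m + 1),
      T.tensorOp (Nat.add_comm 1 m) (X 1) (T.compositionSum X m) =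
        T.tensorOp h (X j) (T.compositionSum X k) := by
    rintro j k rfl rfl h
    rfl
  rw [T.compositionSum_succ hX, hfirst (((0 : Fin (m + 1)) : ℕ) + 1) (m - ((0 : Fin (m + 1)) : ℕ))
    (by simp) (by simp) (by simp [Nat.add_comm])]
  exact Finset.single_le_sum (f := fun i : Fin (m + 1) =>
      T.tensorOp (by omega : (i + 1 : ℕ) + (m - i) = m + 1) (X (i + 1))
        (T.compositionSum X (m - i)))
    (fun i _ => T.tensorOp_nonneg _ (hX.nonneg _ (Nat.succ_pos _)) (T.compositionSum_nonneg hX _)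
      (T.compositionSum_mem_commutant hX _)) (Finset.mem_univ 0)

end TensorPowers

namespace TensorPowers

variable {M : Type u} [CStarAlgebra M] [PartialOrder M] [StarOrderedRing M]
  {E : WStarCorrespondence.{u, v} M} (T : TensorPowers.{u, v, w} E)

/-! ### The operators `I ⊗ B` -/

theorem tensorOp_zero_left {m : ℕ} {B : (T.pow m).Op} (hB : B ∈ T.commutant m) :
    T.tensorOp (Nat.zero_add m) 1 B = B :=
  T.op_ext (Nat.zero_add m) fun x y => by
    obtain ⟨a, rfl⟩ := T.zeroIso.toEquiv.surjective x
    rw [T.tensorOp_tmul _ _ hB, AdjointableOp.one_apply]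
    exact (T.zero_tmul a (B y)).trans
      ((T.apply_left_of_mem_commutant hB a y).symm.trans (congrArg B (T.zero_tmul a y).symm))

theorem idTensor_mem_commutant {k : ℕ} {B : (T.pow k).Op} (hB : B ∈ T.commutant k) :
    T.idTensor B ∈ T.commutant (k + 1) :=
  T.tensorOp_mem_commutant _ (one_mem _) hB

theorem idTensor_mul {k : ℕ} {B B' : (T.pow k).Op} (hB : B ∈ T.commutant k)
    (hB' : B' ∈ T.commutant k) : T.idTensor (B * B') = T.idTensor B * T.idTensor B' := by
  have h := T.tensorOp_mul (Nat.add_comm 1 k) 1 1 hB hB'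
  rwa [one_mul] at h

theorem idTensor_one (k : ℕ) : T.idTensor (1 : (T.pow k).Op) = 1 :=
  T.tensorOp_one_one _

theorem idTensor_nonneg {k : ℕ} {B : (T.pow k).Op} (hB : B ∈ T.commutant k) (h0 : 0 ≤ B) :
    0 ≤ T.idTensor B :=
  T.tensorOp_nonneg _ zero_le_one h0 hB

theorem idTensor_mul_ringInverse {k : ℕ} {B : (T.pow k).Op} (hB : B ∈ T.commutant k)
    (hu : IsUnit B) : T.idTensor B * T.idTensor (Ring.inverse B) = 1 := by
  rw [← T.idTensor_mul hB (T.inverse_mem_commutant hB), Ring.mul_inverse_cancel B hu, idTensor_one]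

theorem isUnit_idTensor {k : ℕ} {B : (T.pow k).Op} (hB : B ∈ T.commutant k) (hu : IsUnit B) :
    IsUnit (T.idTensor B) := by
  refine isUnit_iff_exists.2 ⟨T.idTensor (Ring.inverse B), T.idTensor_mul_ringInverse hB hu, ?_⟩
  rw [← T.idTensor_mul (T.inverse_mem_commutant hB) hB, Ring.inverse_mul_cancel B hu, idTensor_one]

/-- `I_{i+1} ⊗ B = I_E ⊗ (I_i ⊗ B)`. -/
theorem idTensor_tensorOp_one {i m k : ℕ} (h : i + m = k) (h' : i + 1 + m = k + 1)
    {B : (T.pow m).Op} (hB : B ∈ T.commutant m) :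
    T.idTensor (T.tensorOp h 1 B) = T.tensorOp h' 1 B := by
  rw [idTensor, ← T.tensorOp_assoc (Nat.add_comm 1 i) h' h (Nat.add_comm 1 k) 1 (one_mem _) hB,
    tensorOp_one_one]

theorem real_tensorOp_smul_left {l m n : ℕ} (h : l + m = n) (c : ℝ) (A : (T.pow l).Op)
    {B : (T.pow m).Op} (hB : B ∈ T.commutant m) :
    T.tensorOp h (c • A) B = c • T.tensorOp h A B :=
  T.tensorOp_smul_left h (c : ℂ) A hB

theorem real_idTensor_smul {k : ℕ} (c : ℝ) {B : (T.pow k).Op} (hB : B ∈ T.commutant k) :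
    T.idTensor (c • B) = c • T.idTensor B :=
  T.tensorOp_smul_right _ (c : ℂ) 1 hB

/-! ### Comparison of `R_{m+1}²` with `I ⊗ R_m²` -/

variable {X : T.OpSeq} (hX : T.IsAdmissible X) {a : ℝ} (ha : 0 < a)
  (haX : a • (1 : (T.pow 1).Op) ≤ X 1)
include hX haX

theorem smul_idTensor_compositionSum_le (m : ℕ) :
    a • T.idTensor (T.compositionSum X m) ≤ T.compositionSum X (m + 1) := by
  have hS := T.compositionSum_mem_commutant hX m
  refine le_trans ?_ (T.tensorOp_one_compositionSum_le hX m)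
  rw [idTensor, ← T.real_tensorOp_smul_left _ _ _ hS]
  exact T.tensorOp_mono_left _ haX (T.compositionSum_nonneg hX m) hS

include ha

theorem pow_smul_tensorOp_compositionSum_le (i m : ℕ) {n : ℕ} (h : i + m = n) :
    a ^ i • T.tensorOp h 1 (T.compositionSum X m) ≤ T.compositionSum X n := by
  have hS := T.compositionSum_mem_commutant hX m
  induction i generalizing n with
  | zero =>
    obtain rfl : m = n := by omega
    rw [T.tensorOp_zero_left hS, pow_zero, one_smul]
  | succ i ih =>
    obtain rfl : i + m + 1 = n := by omega
    have hT : T.tensorOp (rfl : i + m = i + m) 1 (T.compositionSum X m) ∈ T.commutant (i + m) :=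
      T.tensorOp_mem_commutant _ (one_mem _) hS
    have h1 := T.tensorOp_mono_right (Nat.add_comm 1 (i + m)) (zero_le_one (α := (T.pow 1).Op))
      (ih rfl) ((T.commutant (i + m)).smul_mem hT ((a ^ i : ℝ) : ℂ))
      (T.compositionSum_mem_commutant hX (i + m))
    change T.idTensor (a ^ i • T.tensorOp rfl 1 (T.compositionSum X m)) ≤
      T.idTensor (T.compositionSum X (i + m)) at h1
    rw [T.real_idTensor_smul _ hT, T.idTensor_tensorOp_one rfl h hS] at h1
    rw [pow_succ', mul_smul]
    exact (smul_le_smul_of_nonneg_left h1 ha.le).trans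
      (T.smul_idTensor_compositionSum_le hX haX (i + m))

theorem isUnit_compositionSum (m : ℕ) : IsUnit (T.compositionSum X m) := by
  have h := T.pow_smul_tensorOp_compositionSum_le hX ha haX m 0 (Nat.add_zero m)
  rw [compositionSum_zero, tensorOp_one_one] at h
  have ham : 0 < a ^ m := by positivity
  refine CStarAlgebra.isUnit_of_le _ h (IsUnit.isStrictlyPositive ?_
    (smul_nonneg ham.le zero_le_one))
  exact isUnit_one.smul (Units.mk0 (a ^ m) ham.ne')

theorem isUnit_R (m : ℕ) : IsUnit (T.R X m) :=
  (CFC.isUnit_sqrt_iff _ (T.compositionSum_nonneg hX m)).2 (T.isUnit_compositionSum hX ha haX m)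

/-- Each summand satisfies `X_{i+1} ⊗ R_{m-i}² ≤ ‖X_{i+1}‖ a^{-i} (I_E ⊗ R_m²)`, because
`a^i (I_i ⊗ R_{m-i}²) ≤ R_m²`. -/
theorem compositionSum_succ_le_smul_idTensor (m : ℕ) :
    T.compositionSum X (m + 1) ≤
      (∑ i ∈ Finset.range (m + 1), ‖X (i + 1)‖ / a ^ i) • T.idTensor (T.compositionSum X m) := by
  rw [T.compositionSum_succ hX, Finset.sum_range, Finset.sum_smul]
  refine Finset.sum_le_sum fun i _ => ?_
  have hi : (i : ℕ) + (m - i) = m := by omega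
  have hS := T.compositionSum_mem_commutant hX (m - i)
  have hT : T.tensorOp hi 1 (T.compositionSum X (m - i)) ∈ T.commutant m :=
    T.tensorOp_mem_commutant _ (one_mem _) hS
  have h1 : X (i + 1) ≤ ‖X (i + 1)‖ • (1 : (T.pow (i + 1)).Op) := by
    rw [← Algebra.algebraMap_eq_smul_one]
    exact (hX.nonneg _ (Nat.succ_pos _)).isSelfAdjoint.le_algebraMap_norm_self
  have h2 := T.tensorOp_mono_left (by omega : (i + 1 : ℕ) + (m - i) = m + 1) h1
    (T.compositionSum_nonneg hX (m - i)) hS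
  rw [T.real_tensorOp_smul_left _ _ _ hS] at h2
  have h3 := T.tensorOp_mono_right (Nat.add_comm 1 m) (zero_le_one (α := (T.pow 1).Op))
    (T.pow_smul_tensorOp_compositionSum_le hX ha haX i (m - i) hi)
    ((T.commutant m).smul_mem hT ((a ^ (i : ℕ) : ℝ) : ℂ)) (T.compositionSum_mem_commutant hX m)
  change T.idTensor (a ^ (i : ℕ) • T.tensorOp hi 1 (T.compositionSum X (m - i))) ≤
    T.idTensor (T.compositionSum X m) at h3
  rw [T.real_idTensor_smul _ hT, T.idTensor_tensorOp_one hi (by omega) hS] at h3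
  have h4 := smul_le_smul_of_nonneg_left h3
    (by positivity : 0 ≤ ‖X (i + 1)‖ / a ^ (i : ℕ))
  rw [smul_smul, div_mul_cancel₀ _ (by positivity)] at h4
  exact h2.trans h4

omit ha haX hX

/-! ### The weight sequence `Z_m = R_m⁻¹ (I ⊗ R_{m-1})` -/

variable (X) in
/-- The weights `Z_m = R_m⁻¹ (I_E ⊗ R_{m-1})`, `Z_0 = I`. -/
noncomputable def quotientWeight : T.OpSeq
  | 0 => 1
  | m + 1 => Ring.inverse (T.R X (m + 1)) * T.idTensor (T.R X m)

include hX in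
/-- The product telescopes: `Z^{(m)} = R_m⁻¹`. -/
theorem weightProd_quotientWeight (hR : ∀ m, IsUnit (T.R X m)) (m : ℕ) :
    T.weightProd (T.quotientWeight X) m = Ring.inverse (T.R X m) := by
  induction m with
  | zero => rw [R_zero, Ring.inverse_one]; rfl
  | succ m ih =>
    rw [weightProd, ih]
    change Ring.inverse (T.R X (m + 1)) * T.idTensor (T.R X m) * _ = _
    rw [mul_assoc, T.idTensor_mul_ringInverse (T.R_mem_commutant hX m) (hR m), mul_one]

include hX in
theorem R_commute_idTensor (hcomm : T.CommutativityCondition X) (m : ℕ) :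
    Commute (T.R X (m + 1)) (T.idTensor (T.R X m)) := by
  cases m with
  | zero =>
    rw [R_zero, idTensor_one]
    exact Commute.one_right _
  | succ m => exact hcomm (m + 1) (Nat.succ_pos m)

include hX in
theorem idTensor_R_mul_self (m : ℕ) :
    T.idTensor (T.R X m) * T.idTensor (T.R X m) = T.idTensor (T.compositionSum X m) := by
  rw [← T.idTensor_mul (T.R_mem_commutant hX m) (T.R_mem_commutant hX m), T.R_mul_self hX]

include hX in
theorem exists_isAssociated_hypothesisB (hC : T.HypothesisC X) (hcomm : T.CommutativityCondition X) :
    ∃ Z : T.OpSeq, T.IsAssociated X Z ∧ T.HypothesisB Z := by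
  obtain ⟨a, hlim, haX⟩ := hC
  have ha : 0 < a := ENNReal.ofReal_pos.1 (pos_of_gt hlim)
  obtain ⟨C, hC0, hC⟩ := exists_sum_norm_div_pow_le X ha hlim
  have hu := T.isUnit_R hX ha haX
  have hlow : ∀ m, a • (T.idTensor (T.R X m) * T.idTensor (T.R X m)) ≤
      T.R X (m + 1) * T.R X (m + 1) := fun m => by
    rw [T.idTensor_R_mul_self hX, T.R_mul_self hX]
    exact T.smul_idTensor_compositionSum_le hX haX m
  have hup : ∀ m, T.R X (m + 1) * T.R X (m + 1) ≤
      C • (T.idTensor (T.R X m) * T.idTensor (T.R X m)) := fun m => by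
    rw [T.idTensor_R_mul_self hX, T.R_mul_self hX]
    exact (T.compositionSum_succ_le_smul_idTensor hX ha haX m).trans
      (smul_le_smul_of_nonneg_right (hC (m + 1)) (T.idTensor_nonneg
        (T.compositionSum_mem_commutant hX m) (T.compositionSum_nonneg hX m)))
  have hnn := fun m => T.idTensor_nonneg (T.R_mem_commutant hX m) (T.R_nonneg (X := X) m)
  refine ⟨T.quotientWeight X, ⟨⟨?_, rfl, ?_, ?_⟩, fun m => ?_⟩, (√C)⁻¹, by positivity, ?_⟩
  · rintro (_ | m)
    · exact T.mem_commutant_iff.1 (one_mem _)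
    · exact T.mem_commutant_iff.1 (mul_mem (T.inverse_mem_commutant (T.R_mem_commutant hX _))
        (T.idTensor_mem_commutant (T.R_mem_commutant hX m)))
  · refine ⟨max ‖(1 : (T.pow 0).Op)‖ (√a)⁻¹, ?_⟩
    rintro _ ⟨_ | m, rfl⟩
    · exact le_max_left _ _
    · exact (norm_ringInverse_mul_le (T.R_nonneg _) (hu _) (hnn m)
        (T.R_commute_idTensor hX hcomm m) ha (hlow m)).trans (le_max_right _ _)
  · rintro (_ | m)
    · exact isUnit_one
    · exact (hu (m + 1)).ringInverse.mul (T.isUnit_idTensor (T.R_mem_commutant hX m) (hu m))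
  · rw [T.weightProd_quotientWeight hX hu, sq, Ring.inverse_mul (Or.inl (hu m)),
      (ringInverse_nonneg (T.R_nonneg m)).isSelfAdjoint.star_eq]
  · rintro (_ | m) hm
    · exact absurd hm (by simp)
    · exact le_ringInverse_mul (T.R_nonneg _) (hu _) (hnn m) (T.R_commute_idTensor hX hcomm m) hC0
        (hup m)

end TensorPowers

/-! ### Isomorphisms of correspondences -/

namespace WStarCorrespondence.Iso

variable {M : Type u} [CStarAlgebra M] [PartialOrder M] [StarOrderedRing M]
  {E : WStarCorrespondence.{u, v} M} {F : WStarCorrespondence.{u, w} M} (f : E.Iso F)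

theorem minner_map (x y : E) : minner M (f.toEquiv x) (f.toEquiv y) = minner M x y :=
  f.inner_map x y

theorem ext_right {x y : F} (h : ∀ z, minner M (f.toEquiv z) x = minner M (f.toEquiv z) y) :
    x = y :=
  minner_ext (M := M) fun z => by
    obtain ⟨z, rfl⟩ := f.toEquiv.surjective z
    exact h z

theorem map_add (x y : E) : f.toEquiv (x + y) = f.toEquiv x + f.toEquiv y :=
  f.ext_right fun z => by simp only [minner_map, minner_add_right]

theorem map_smul (c : ℂ) (x : E) : f.toEquiv (c • x) = c • f.toEquiv x :=
  f.ext_right fun z => by simp only [minner_map, minner_smul_right]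

theorem map_opSMul (a : Mᵐᵒᵖ) (x : E) : f.toEquiv (a • x) = a • f.toEquiv x :=
  f.ext_right fun z => by simp only [minner_map, minner_opSMul_right]

end WStarCorrespondence.Iso

namespace TensorPowers

/-! ### Commutants in the first factor -/

section FirstFactor

variable {M : Type u} [CStarAlgebra M] [PartialOrder M] [StarOrderedRing M]
  {E : WStarCorrespondence.{u, v} M} (T : TensorPowers.{u, v, w} E) {X : T.OpSeq}

theorem commutativityCondition_of_commutantsInFirstFactor (hX : T.IsAdmissible X)
    (h : T.CommutantsInFirstFactor) : T.CommutativityCondition X := by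
  intro k hk
  have hR := T.R_mem_commutant hX k
  obtain ⟨B, hB⟩ := h k hk _ (T.mem_commutant_iff.1 (T.R_mem_commutant hX (k + 1)))
  rw [hB, idTensor, ← T.tensorOp_mul _ _ _ (one_mem _) hR,
    ← T.tensorOp_mul _ _ _ hR (one_mem _), one_mul, mul_one, one_mul, mul_one]

end FirstFactor

/-! ### The correspondence of an automorphism -/

section Twist

variable {M : Type u} [CStarAlgebra M] [PartialOrder M] [StarOrderedRing M]

/-- An isomorphism with `_βM`, as a bijection on `M`. -/
def twistMap {β : M ≃⋆ₐ[ℂ] M} {F : WStarCorrespondence.{u, w} M}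
    (f : (WStarCorrespondence.twist β).Iso F) : M ≃ F := f.toEquiv

theorem minner_twistMap {β : M ≃⋆ₐ[ℂ] M} {F : WStarCorrespondence.{u, w} M}
    (f : (WStarCorrespondence.twist β).Iso F) (x y : M) :
    minner M (twistMap f x) (twistMap f y) = star x * y := f.inner_map x y

theorem left_twistMap {β : M ≃⋆ₐ[ℂ] M} {F : WStarCorrespondence.{u, w} M}
    (f : (WStarCorrespondence.twist β).Iso F) (a x : M) :
    F.left a (twistMap f x) = twistMap f (β a * x) := (f.left_map a x).symm

theorem opSMul_twistMap {β : M ≃⋆ₐ[ℂ] M} {F : WStarCorrespondence.{u, w} M}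
    (f : (WStarCorrespondence.twist β).Iso F) (a x : M) :
    op a • twistMap f x = twistMap f (x * a) := (f.map_opSMul (op a) x).symm

/-- The commutant of the left action of `_βM` is central in `𝓛(_βM)`: it consists of the
multiplications by the centre of `M`. -/
theorem commute_of_twist_iso {β : M ≃⋆ₐ[ℂ] M} {F : WStarCorrespondence.{u, w} M}
    (f : (WStarCorrespondence.twist β).Iso F) (A : F.Op) {B : F.Op}
    (hB : B ∈ F.leftCommutant) : A * B = B * A := by
  -- an operator in the commutant is both left and right multiplication by its value at `1`
  have hleft : ∀ {A : F.Op} {a : M}, A ∈ F.leftCommutant → A (twistMap f 1) = twistMap f a →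
      ∀ x, A (twistMap f x) = twistMap f (x * a) := fun {A a} hA ha x => by
    have h1 := congrArg (fun C : F.Op => C (twistMap f 1)) (hA (β.symm x))
    simp only [AdjointableOp.mul_apply, left_twistMap, ha, mul_one,
      StarAlgEquiv.apply_symm_apply] at h1
    exact h1
  have hright : ∀ {A : F.Op} {a : M}, A (twistMap f 1) = twistMap f a →
      ∀ x, A (twistMap f x) = twistMap f (a * x) := fun {A a} ha x => by
    rw [← opSMul_twistMap, ← ha, ← AdjointableOp.map_opSMul, opSMul_twistMap, one_mul]
  obtain ⟨a, ha⟩ := (twistMap f).surjective (A (twistMap f 1))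
  obtain ⟨b, hb⟩ := (twistMap f).surjective (B (twistMap f 1))
  refine AdjointableOp.ext fun y => ?_
  obtain ⟨x, rfl⟩ := (twistMap f).surjective y
  rw [AdjointableOp.mul_apply, AdjointableOp.mul_apply, hright ha.symm, hleft hB hb.symm,
    hleft hB hb.symm, hright ha.symm, mul_assoc]

variable {α : M ≃⋆ₐ[ℂ] M} (T : TensorPowers.{u, u, w} (WStarCorrespondence.twist α))

/-- The tensor powers of `_αM` are again correspondences of automorphisms, by the map
`x ↦ 1 ⊗ v x`. -/
theorem exists_twist_iso (k : ℕ) :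
    ∃ β : M ≃⋆ₐ[ℂ] M, Nonempty ((WStarCorrespondence.twist β).Iso (T.pow k)) := by
  induction k with
  | zero => exact ⟨_, ⟨T.zeroIso⟩⟩
  | succ k ih =>
    obtain ⟨β, ⟨f⟩⟩ := ih
    have h : 1 + k = k + 1 := Nat.add_comm 1 k
    let g : M → T.pow (k + 1) := fun x => T.tmul h (twistMap T.oneIso 1) (twistMap f x)
    have hg : ∀ x y, minner M (g x) (g y) = star x * y := fun x y => by
      simp only [g, minner_tmul, minner_twistMap, star_one, one_mul, map_one,
        AdjointableOp.one_apply]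
    have hgs : ∀ a x, op a • g x = g (x * a) := fun a x => by
      simp only [g, ← tmul_opSMul, opSMul_twistMap]
    -- an elementary tensor is moved into the second factor by balancedness
    have ht : ∀ x y, T.tmul h (twistMap T.oneIso x) (twistMap f y) = g (β x * y) := fun x y => by
      simp only [g]
      rw [← left_twistMap, ← opSMul_tmul, opSMul_twistMap, one_mul]
    have hinj : Function.Injective g := fun x y hxy => by
      have h1 := hg 1 x
      rw [hxy, hg] at h1
      simpa using h1.symm
    have hsurj : Function.Surjective g := fun z => by
      refine ⟨minner M (g 1) z, T.ext_right h fun x y => ?_⟩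
      obtain ⟨x, rfl⟩ := (twistMap T.oneIso).surjective x
      obtain ⟨y, rfl⟩ := (twistMap f).surjective y
      rw [ht, hg]
      have h2 := hgs (β x * y) 1
      rw [one_mul] at h2
      rw [← h2, minner_opSMul_left, unop_op]
    refine ⟨α.trans β, ⟨{ toEquiv := Equiv.ofBijective g ⟨hinj, hsurj⟩
                          inner_map := hg
                          left_map := fun a (x : M) => ?_ }⟩⟩
    change g (β (α a) * x) = (T.pow (k + 1)).left a (T.tmul h (twistMap T.oneIso 1) (twistMap f x))
    rw [(T.isTensorProduct h).left_tmul, left_twistMap, mul_one, ht]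

theorem commutativityCondition_of_twist {X : T.OpSeq} (hX : T.IsAdmissible X) :
    T.CommutativityCondition X := by
  intro k _
  obtain ⟨β, ⟨f⟩⟩ := T.exists_twist_iso (k + 1)
  exact commute_of_twist_iso f _
    (T.mem_commutant_iff.1 (T.idTensor_mem_commutant (T.R_mem_commutant hX k)))

end Twist

/-! ### Diagonal sequences -/

section Diagonal

variable {d : ℕ} (T : TensorPowers.{0, 0, w} (WStarCorrespondence.euclidean d))

/-- The vectors `e_{w₁} ⊗ ⋯ ⊗ e_{w_k}` separate the points of `(ℂᵈ)^{⊗k}`. -/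
theorem eq_zero_of_minner_basisVector {k : ℕ} {g : T.pow k}
    (hg : ∀ i, minner ℂ g (T.basisVector k i) = 0) : g = 0 := by
  induction k with
  | zero =>
    refine minner_ext_left (M := ℂ) fun z => ?_
    obtain ⟨c, rfl⟩ := T.zeroIso.toEquiv.surjective z
    have h1 : ∀ c : ℂ, T.zeroIso.toEquiv c = op c • T.zeroIso.toEquiv (1 : ℂ) := fun c => by
      rw [← T.zeroIso.map_opSMul (op c) (1 : ℂ)]
      exact congrArg T.zeroIso.toEquiv (one_mul c).symm
    rw [h1 c, minner_opSMul_right, minner_zero_left]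
    have h2 : minner ℂ g (T.zeroIso.toEquiv (1 : ℂ)) = 0 := hg Fin.elim0
    rw [h2, smul_zero]
  | succ k ih =>
    have h : 1 + k = k + 1 := Nat.add_comm 1 k
    refine (T.isSelfDualCompletion h).ext_left fun p => ?_
    obtain ⟨x, y⟩ := p
    obtain ⟨x, rfl⟩ := T.oneIso.toEquiv.surjective x
    rw [minner_zero_left]
    change minner ℂ g (T.tmul h (T.oneIso.toEquiv x) y) = 0
    have hbasis : ∀ j : Fin d,
        minner ℂ g (T.tmul h (T.oneIso.toEquiv (EuclideanSpace.single j (1 : ℂ))) y) = 0 := by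
      intro j
      obtain ⟨u, hu⟩ := (T.pow k).selfDual
        (T.minnerTmulCLM h g (T.oneIso.toEquiv (EuclideanSpace.single j (1 : ℂ))))
      have hu0 : u = 0 := ih fun i => by
        have h1 := hg (Fin.cons j i)
        rw [basisVector, Fin.tail_cons, Fin.cons_zero] at h1
        rw [← hu]
        exact h1
      have h2 := hu y
      rw [hu0, minner_zero_left] at h2
      exact h2
    let φ : EuclideanSpace ℂ (Fin d) →ₗ[ℂ] ℂ :=
      { toFun := fun x => minner ℂ g (T.tmul h (T.oneIso.toEquiv x) y)
        map_add' := fun x x' => by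
          rw [← minner_add_right, ← add_tmul]
          exact congrArg (fun z => minner ℂ g (T.tmul h z y)) (T.oneIso.map_add x x')
        map_smul' := fun c x => by
          rw [RingHom.id_apply, ← minner_smul_right, ← smul_tmul]
          exact congrArg (fun z => minner ℂ g (T.tmul h z y)) (T.oneIso.map_smul c x) }
    have hφ : φ = 0 := (EuclideanSpace.basisFun (Fin d) ℂ).toBasis.ext fun j => by
      rw [OrthonormalBasis.coe_toBasis, EuclideanSpace.basisFun_apply]
      exact hbasis j
    exact congrArg (fun ψ : EuclideanSpace ℂ (Fin d) →ₗ[ℂ] ℂ => ψ x) hφ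

theorem op_ext_basisVector {k : ℕ} {A B : (T.pow k).Op}
    (h : ∀ i, A (T.basisVector k i) = B (T.basisVector k i)) : A = B :=
  AdjointableOp.ext fun x => minner_ext (M := ℂ) fun g => by
    rw [← AdjointableOp.star_minner_apply, ← AdjointableOp.star_minner_apply, ← sub_eq_zero,
      ← minner_sub_left, T.eq_zero_of_minner_basisVector (g := star A g - star B g),
      minner_zero_left]
    intro i
    rw [minner_sub_left, AdjointableOp.star_minner_apply, AdjointableOp.star_minner_apply, h,
      sub_self]

/-- Basis vectors split along every decomposition of the number of factors. -/
theorem exists_basisVector_eq_tmul {l m n : ℕ} (h : l + m = n) (i : Fin n → Fin d) :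
    ∃ i₁ i₂, T.basisVector n i = T.tmul h (T.basisVector l i₁) (T.basisVector m i₂) := by
  induction l generalizing n with
  | zero =>
    obtain rfl : m = n := by omega
    refine ⟨Fin.elim0, i, ?_⟩
    refine (Eq.trans (T.zero_tmul (1 : ℂ) (T.basisVector m i)) ?_).symm
    rw [map_one, AdjointableOp.one_apply]
  | succ l ih =>
    obtain rfl : l + m + 1 = n := by omega
    obtain ⟨i₁, i₂, hi⟩ := ih rfl (Fin.tail i)
    refine ⟨Fin.cons (i 0) i₁, i₂, ?_⟩
    rw [basisVector, basisVector, hi, Fin.tail_cons, Fin.cons_zero]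
    exact (T.tmul_assoc _ _ _ _ _ _ _).symm

variable {T}

theorem IsDiagonal.one {k : ℕ} : T.IsDiagonal (1 : (T.pow k).Op) := fun i =>
  ⟨1, by rw [AdjointableOp.one_apply, one_smul]⟩

theorem IsDiagonal.sum {ι : Type*} (s : Finset ι) {k : ℕ} {A : ι → (T.pow k).Op}
    (hA : ∀ j, T.IsDiagonal (A j)) : T.IsDiagonal (∑ j ∈ s, A j) := fun i => by
  choose c hc using fun j => hA j i
  exact ⟨∑ j ∈ s, c j, by simp only [AdjointableOp.sum_apply, hc, Finset.sum_smul]⟩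

theorem IsDiagonal.tensorOp {l m n : ℕ} (h : l + m = n) {A : (T.pow l).Op} {B : (T.pow m).Op}
    (hA : T.IsDiagonal A) (hB : T.IsDiagonal B) (hBc : B ∈ T.commutant m) :
    T.IsDiagonal (T.tensorOp h A B) := fun i => by
  obtain ⟨i₁, i₂, hi⟩ := T.exists_basisVector_eq_tmul h i
  obtain ⟨a, ha⟩ := hA i₁
  obtain ⟨b, hb⟩ := hB i₂
  exact ⟨a * b, by rw [hi, T.tensorOp_tmul h A hBc, ha, hb, smul_tmul, tmul_smul, smul_smul]⟩

theorem IsDiagonal.commute {k : ℕ} {A B : (T.pow k).Op} (hA : T.IsDiagonal A)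
    (hB : T.IsDiagonal B) : Commute A B :=
  T.op_ext_basisVector fun i => by
    obtain ⟨a, ha⟩ := hA i
    obtain ⟨b, hb⟩ := hB i
    rw [AdjointableOp.mul_apply, AdjointableOp.mul_apply, ha, hb, AdjointableOp.map_smul,
      AdjointableOp.map_smul, ha, hb, smul_comm]

variable {X : T.OpSeq} (hX : T.IsAdmissible X) (hd : ∀ k, 1 ≤ k → T.IsDiagonal (X k))
include hX hd

theorem IsDiagonal.tensorList (c : List ℕ) (hc : ∀ a ∈ c, 1 ≤ a) {n : ℕ} (h : c.sum = n) :
    T.IsDiagonal (T.tensorList X c h) := by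
  induction c generalizing n with
  | nil => exact IsDiagonal.one
  | cons a c ih =>
    have hc' : ∀ b ∈ c, 1 ≤ b := fun b hb => hc b (List.mem_cons_of_mem _ hb)
    exact IsDiagonal.tensorOp _ (hd a (hc a List.mem_cons_self)) (ih hc' rfl)
      (T.tensorList_mem_commutant hX c hc' rfl)

theorem IsDiagonal.compositionSum (k : ℕ) : T.IsDiagonal (T.compositionSum X k) :=
  IsDiagonal.sum _ fun c => IsDiagonal.tensorList hX hd _ (fun _ ha => c.blocks_pos ha) _

/-- The squares `R_{k+1}²` and `I_E ⊗ R_k²` are diagonal, hence commute, and so do their square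
roots. -/
theorem commutativityCondition_of_isDiagonal : T.CommutativityCondition X := by
  intro k _
  have hS := T.compositionSum_mem_commutant hX k
  have h1 : T.idTensor (T.R X k) = CFC.sqrt (T.idTensor (T.compositionSum X k)) :=
    (CFC.sqrt_unique (T.idTensor_R_mul_self hX k)
      (T.idTensor_nonneg (T.R_mem_commutant hX k) (T.R_nonneg k))).symm
  rw [h1]
  exact ((IsDiagonal.compositionSum hX hd (k + 1)).commute
    (IsDiagonal.one.tensorOp _ (IsDiagonal.compositionSum hX hd k) hS)).cfcSqrt_cfcSqrt

end Diagonal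

end TensorPowers

theorem mainTheorem12 {M : Type u} [CStarAlgebra M] [PartialOrder M] [StarOrderedRing M]
    [WStarAlgebra M] :
    -- the general result, for every W*-correspondence `E` over `M`
    (∀ (E : WStarCorrespondence.{u, v} M) (T : TensorPowers.{u, v, w} E) (X : T.OpSeq),
      T.IsAdmissible X → T.HypothesisC X → T.CommutativityCondition X →
        ∃ Z : T.OpSeq, T.IsAssociated X Z ∧ T.HypothesisB Z) ∧
    -- a sufficient condition for the commutativity condition
    (∀ (E : WStarCorrespondence.{u, v} M) (T : TensorPowers.{u, v, w} E) (X : T.OpSeq),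
      T.CommutantsInFirstFactor → T.IsAdmissible X →
        T.CommutativityCondition X ∧
          (T.HypothesisC X → ∃ Z : T.OpSeq, T.IsAssociated X Z ∧ T.HypothesisB Z)) ∧
    -- the case `E = _αM`
    (∀ (α : M ≃⋆ₐ[ℂ] M) (T : TensorPowers.{u, u, w} (WStarCorrespondence.twist α))
        (X : T.OpSeq), T.IsAdmissible X →
        T.CommutativityCondition X ∧
          (T.HypothesisC X → ∃ Z : T.OpSeq, T.IsAssociated X Z ∧ T.HypothesisB Z)) ∧
    -- the case `M = ℂ`, `E = ℂᵈ`, with diagonal `X_k`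
    (∀ (d : ℕ) (T : TensorPowers.{0, 0, w} (WStarCorrespondence.euclidean d)) (X : T.OpSeq),
      T.IsAdmissible X → (∀ k, 1 ≤ k → T.IsDiagonal (X k)) →
        T.CommutativityCondition X ∧
          (T.HypothesisC X → ∃ Z : T.OpSeq, T.IsAssociated X Z ∧ T.HypothesisB Z)) := by
  refine ⟨fun E T X hX hcomm hC => T.exists_isAssociated_hypothesisB hX hcomm hC,
    fun E T X h hX => ?_, fun α T X hX => ?_, fun d T X hX hd => ?_⟩
  · have hcomm := T.commutativityCondition_of_commutantsInFirstFactor hX h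
    exact ⟨hcomm, fun hC => T.exists_isAssociated_hypothesisB hX hC hcomm⟩
  · have hcomm := T.commutativityCondition_of_twist hX
    exact ⟨hcomm, fun hC => T.exists_isAssociated_hypothesisB hX hC hcomm⟩
  · have hcomm := TensorPowers.commutativityCondition_of_isDiagonal hX hd
    exact ⟨hcomm, fun hC => T.exists_isAssociated_hypothesisB hX hC hcomm⟩
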